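/- Let $(T,\Sigma,\mu)$ be a $\sigma$-finite, non-atomic measure space and let $\Phi\colon T\times[0,\infty]\to[0,\infty]$ be a Musielak--Orlicz function: $\Phi(\cdot,u)$ is measurable for every $u\ge 0$, and for $\mu$-a.e. $t\in T$ the function $\Phi(t,\cdot)$ is convex and lower semi-continuous on $[0,\infty]$ with $\Phi(t,0)=\lim_{u\downarrow 0}\Phi(t,u)=0$ and $\Phi(t,\infty)=\infty$. Let $\Phi^*(t,v)=\sup_{u>0}(uv-\Phi(t,u))$ be the complementary function, and put $a_{\Phi^*}(t)=\sup\{v\ge 0:\Phi^*(t,v)=0\}$ and $b_{\Phi^*}(t)=\sup\{v\ge 0:\Phi^*(t,v)<\infty\}$. For $\Psi\in\{\Phi,\Phi^*\}$ and measurable $w\colon T\to[-\infty,\infty]$ put $I_\Psi(w)=\int_T\Psi(t,|w(t)|)\,d\mu$. Let $L_0^\Phi$ be the real vector space of all ($\mu$-a.e. classes of) measurable functions $u\colon T\to\mathbb R$ such that $I_\Phi(\lambda u)<\infty$ for some $\lambda>0$, equipped with the Orlicz norm $$\|u\|_{\Phi,0}=\sup\Bigl\{\Bigl|\int_T uv\,d\mu\Bigr|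 : v\colon T\to\mathbb R \text{ measurable},\ I_{\Phi^*}(v)\le 1\Bigr\}.$$ For $u\in L_0^\Phi$ let $K(u)$ be the set of all $k>0$ at which the infimum $\inf_{k>0}\frac1k\bigl(1+I_\Phi(ku)\bigr)$ is attained, and let $\operatorname{supp}u=\{t\in T:u(t)\ne 0\}$. A point $u\neq 0$ of $L_0^\Phi$ is called a smooth point if there is exactly one bounded linear functional $f$ on $L_0^\Phi$ with $\|f\|=1$ and $f(u)=\|u\|_{\Phi,0}$. Let $u\in L_0^\Phi\setminus\{0\}$ be such that $K(u)=\emptyset$. Then $u$ is a smooth point of $L_0^\Phi$ if and only if (i) $I_{\Phi^*}(b_{\Phi^*}\chi_{\operatorname{supp}u})=1$ and $a_{\Phi^*}=0$ $\mu$-a.e. on $T\setminus\operatorname{supp}u$, or (ii) $I_{\Phi^*}(b_{\Phi^*})<1$ and $\mu(T\setminus\operatorname{supp}u)=0$. -/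

import Mathlib

open MeasureTheory Filter Topology Set
open scoped ENNReal NNReal Pointwise

/-- A measure is non-atomic if every measurable set of positive measure has a measurable subset
whose measure is positive and strictly smaller. -/
def IsNonatomic {T : Type*} [MeasurableSpace T] (μ : Measure T) : Prop :=
  ∀ A : Set T, MeasurableSet A → 0 < μ A →
    ∃ B : Set T, MeasurableSet B ∧ B ⊆ A ∧ 0 < μ B ∧ μ B < μ A

/-- The conditions on the section `Φ(t, ·) : [0, ∞] → [0, ∞]`: it is convex and lower
semi-continuous on `[0, ∞]`, vanishes at `0`, tends to `0` at `0+`, and is `∞` at `∞`. -/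
structure IsYoungFunction (φ : ℝ≥0∞ → ℝ≥0∞) : Prop where
  convexOn : ConvexOn ℝ≥0 univ φ
  lowerSemicontinuous : LowerSemicontinuous φ
  map_zero : φ 0 = 0
  tendsto_zero : Tendsto φ (𝓝[>] 0) (𝓝 0)
  map_top : φ ∞ = ∞

/-- Musielak--Orlicz functions `Φ : T × [0, ∞] → [0, ∞]`. -/
structure MusielakOrlicz {T : Type*} [MeasurableSpace T] (μ : Measure T) where
  toFun : T → ℝ≥0∞ → ℝ≥0∞
  ae_isYoungFunction : ∀ᵐ t ∂μ, IsYoungFunction (toFun t)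
  measurable : ∀ u : ℝ≥0∞, Measurable fun t => toFun t u

/-- The complementary function `Φ*(t, v) = sup_{u > 0} (u v - Φ(t, u))`. The subtraction is
truncated at `0`; this does not change the supremum, which is nonnegative because
`u v - Φ(t, u) → 0` as `u → 0+` for finite `v` (and is `∞` for `v = ∞`). -/
noncomputable def complementary {T : Type*} (Φ : T → ℝ≥0∞ → ℝ≥0∞) (t : T) (v : ℝ≥0∞) : ℝ≥0∞ :=
  ⨆ (u : ℝ≥0) (_ : 0 < u), ((u : ℝ≥0∞) * v - Φ t u)

/-- `a_Φ(t) = sup {u ≥ 0 : Φ(t, u) = 0}`. -/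
noncomputable def aFun {T : Type*} (Φ : T → ℝ≥0∞ → ℝ≥0∞) (t : T) : ℝ≥0∞ :=
  sSup {u : ℝ≥0∞ | Φ t u = 0}

/-- `b_Φ(t) = sup {u ≥ 0 : Φ(t, u) < ∞}`. -/
noncomputable def bFun {T : Type*} (Φ : T → ℝ≥0∞ → ℝ≥0∞) (t : T) : ℝ≥0∞ :=
  sSup {u : ℝ≥0∞ | Φ t u < ∞}

/-- The functional `I_Φ(w) = ∫ Φ(t, w(t)) dμ` for `w : T → [0, ∞]`. -/
noncomputable def modular {T : Type*} [MeasurableSpace T] (μ : Measure T)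
    (Φ : T → ℝ≥0∞ → ℝ≥0∞) (w : T → ℝ≥0∞) : ℝ≥0∞ :=
  ∫⁻ t, Φ t (w t) ∂μ

/-- The functional `I_Φ(u) = ∫ Φ(t, |u(t)|) dμ` for real-valued `u`. -/
noncomputable def modularReal {T : Type*} [MeasurableSpace T] (μ : Measure T)
    (Φ : T → ℝ≥0∞ → ℝ≥0∞) (u : T → ℝ) : ℝ≥0∞ :=
  modular μ Φ fun t => ‖u t‖ₑ

section Basic

variable {φ : ℝ≥0∞ → ℝ≥0∞}

theorem IsYoungFunction.map_mul_le (h : IsYoungFunction φ) {c : ℝ≥0} (hc : c ≤ 1) (x : ℝ≥0∞) :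
    φ (c * x) ≤ c * φ x := by
  have := h.convexOn.2 (mem_univ x) (mem_univ (0 : ℝ≥0∞)) (zero_le : 0 ≤ c)
    (zero_le : 0 ≤ 1 - c) (add_tsub_cancel_of_le hc)
  simpa [h.map_zero, ENNReal.smul_def] using this

theorem IsYoungFunction.mono (h : IsYoungFunction φ) : Monotone φ := by
  intro x y hxy
  rcases eq_or_ne y ∞ with rfl | hy
  · simp [h.map_top]
  rcases eq_or_ne y 0 with rfl | hy0
  · rw [nonpos_iff_eq_zero.1 hxy]
  have hle : x / y ≤ 1 := ENNReal.div_le_of_le_mul (by simpa using hxy)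
  have hne : x / y ≠ ∞ := ne_top_of_le_ne_top ENNReal.one_ne_top hle
  have h1 : (x / y).toNNReal ≤ 1 := by
    rw [← ENNReal.coe_le_coe, ENNReal.coe_toNNReal hne]; simpa using hle
  have h2 := h.map_mul_le h1 y
  rw [ENNReal.coe_toNNReal hne, ENNReal.div_mul_cancel hy0 hy] at h2
  exact h2.trans (mul_le_of_le_one_left zero_le hle)

theorem IsYoungFunction.eq_iSup (h : IsYoungFunction φ) (x : ℝ≥0∞) :
    φ x = ⨆ q : ℚ≥0, if ((q : ℝ≥0) : ℝ≥0∞) < x then φ ((q : ℝ≥0) : ℝ≥0∞) else 0 := by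
  apply le_antisymm
  · refine le_of_forall_lt fun c hc => ?_
    have hx : 0 < x := by
      rcases eq_or_ne x 0 with rfl | hx
      · simp [h.map_zero] at hc
      · exact pos_iff_ne_zero.2 hx
    have hev : ∀ᶠ y in 𝓝[<] x, c < φ y :=
      (h.lowerSemicontinuous x c hc).filter_mono nhdsWithin_le_nhds
    obtain ⟨l, hl, hl'⟩ := (mem_nhdsLT_iff_exists_Ioo_subset' hx).1 hev
    obtain ⟨r, hlr, hrx⟩ := exists_between (show l < x from hl)
    obtain ⟨q, hq0, hq1, hq2⟩ := ENNReal.lt_iff_exists_rat_btwn.1 hrx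
    lift q to ℚ≥0 using hq0
    have hcast : ((Real.toNNReal ((q : ℚ) : ℝ) : ℝ≥0) : ℝ≥0∞) = ((q : ℝ≥0) : ℝ≥0∞) := by
      congr 1
      ext
      rw [Real.coe_toNNReal _ (by positivity)]
      simp only [Rat.cast_nnratCast]
      exact (map_nnratCast NNReal.toRealHom q).symm
    rw [hcast] at hq1 hq2
    refine lt_of_lt_of_le (hl' ⟨hlr.trans hq1, hq2⟩) ?_
    refine le_iSup_of_le q ?_
    simp [hq2]
  · refine iSup_le fun q => ?_
    split_ifs with hq
    · exact h.mono hq.le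
    · exact zero_le

theorem complementary_zero {T : Type*} (Φ : T → ℝ≥0∞ → ℝ≥0∞) (t : T) :
    complementary Φ t 0 = 0 := by
  simp [complementary]

theorem mul_le_add_complementary {T : Type*} (Φ : T → ℝ≥0∞ → ℝ≥0∞) (t : T) {u : ℝ≥0∞}
    (hu : u ≠ ∞) (v : ℝ≥0∞) : u * v ≤ complementary Φ t v + Φ t u := by
  rcases eq_or_ne u 0 with rfl | h0
  · simp
  lift u to ℝ≥0 using hu
  rw [← tsub_le_iff_right]
  have : 0 < u := pos_iff_ne_zero.2 (by simpa using h0)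
  exact le_iSup₂_of_le u this le_rfl

theorem IsYoungFunction.exists_one_le (h : IsYoungFunction φ) :
    ∃ n : ℕ, 1 ≤ φ (n + 1 : ℕ) := by
  have hev : ∀ᶠ y in 𝓝 ∞, 1 < φ y := h.lowerSemicontinuous ∞ 1 (by simp [h.map_top])
  have := (ENNReal.tendsto_nat_nhds_top.comp (tendsto_add_atTop_nat 1)).eventually hev
  obtain ⟨n, hn⟩ := this.exists
  exact ⟨n, hn.le⟩

theorem complementary_le_of_one_le {T : Type*} {Φ : T → ℝ≥0∞ → ℝ≥0∞} {t : T}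
    (h : IsYoungFunction (Φ t)) {n : ℕ} (hn : 1 ≤ Φ t (n + 1 : ℕ)) {k : ℕ} :
    complementary Φ t (((n + 1 : ℕ) : ℝ≥0∞)⁻¹ * ((k + 1 : ℕ) : ℝ≥0∞)⁻¹)
      ≤ ((k + 1 : ℕ) : ℝ≥0∞)⁻¹ := by
  set N : ℝ≥0∞ := ((n + 1 : ℕ) : ℝ≥0∞) with hN
  set K : ℝ≥0∞ := ((k + 1 : ℕ) : ℝ≥0∞) with hK
  have hN0 : N ≠ 0 := by simp [hN]
  have hNt : N ≠ ∞ := by simp [hN]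
  have hK1 : K⁻¹ ≤ 1 := by
    rw [ENNReal.inv_le_one, hK]; exact_mod_cast Nat.le_add_left 1 k
  refine iSup₂_le fun u hu => ?_
  rcases le_total (u : ℝ≥0∞) N with huN | huN
  · refine tsub_le_self.trans ?_
    rw [← mul_assoc]
    refine mul_le_of_le_one_left zero_le ?_
    rw [← ENNReal.mul_inv_cancel hN0 hNt]
    gcongr
  · have hu0 : (u : ℝ≥0∞) ≠ 0 := by simpa using hu.ne'
    have hc : N / u ≤ 1 := ENNReal.div_le_of_le_mul (by simpa using huN)
    have hct : N / u ≠ ∞ := ne_top_of_le_ne_top ENNReal.one_ne_top hc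
    have h1 : (N / u).toNNReal ≤ 1 := by
      rw [← ENNReal.coe_le_coe, ENNReal.coe_toNNReal hct]; simpa using hc
    have h2 := h.map_mul_le h1 u
    rw [ENNReal.coe_toNNReal hct, ENNReal.div_mul_cancel hu0 ENNReal.coe_ne_top] at h2
    have h3 : 1 ≤ N / u * Φ t u := hn.trans h2
    have h4 : (u : ℝ≥0∞) * N⁻¹ ≤ Φ t u := by
      calc (u : ℝ≥0∞) * N⁻¹ = u * N⁻¹ * 1 := by rw [mul_one]
        _ ≤ u * N⁻¹ * (N / u * Φ t u) := by gcongr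
        _ = (u * (u : ℝ≥0∞)⁻¹) * (N * N⁻¹) * Φ t u := by rw [ENNReal.div_eq_inv_mul]; ring
        _ = Φ t u := by
          rw [ENNReal.mul_inv_cancel hu0 ENNReal.coe_ne_top, ENNReal.mul_inv_cancel hN0 hNt]
          simp
    have h5 : (u : ℝ≥0∞) * (N⁻¹ * K⁻¹) ≤ Φ t u := by
      rw [← mul_assoc]
      exact (mul_le_of_le_one_right zero_le hK1).trans h4
    rw [tsub_eq_zero_of_le h5]
    exact zero_le

end Basic

section Space

variable {T : Type*} [MeasurableSpace T] {μ : Measure T}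

theorem MusielakOrlicz.aemeasurable (Φ : MusielakOrlicz μ) {w : T → ℝ≥0∞}
    (hw : AEMeasurable w μ) : AEMeasurable (fun t => Φ.toFun t (w t)) μ := by
  have key : AEMeasurable (fun t => ⨆ q : ℚ≥0,
      if ((q : ℝ≥0) : ℝ≥0∞) < hw.mk w t then Φ.toFun t ((q : ℝ≥0) : ℝ≥0∞) else 0) μ :=
    (Measurable.iSup fun q => Measurable.ite
      (measurableSet_lt measurable_const hw.measurable_mk) (Φ.measurable _)
      measurable_const).aemeasurable
  refine key.congr ?_
  filter_upwards [Φ.ae_isYoungFunction, hw.ae_eq_mk] with t ht hwt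
  rw [hwt, ht.eq_iSup]

theorem modularReal_congr (Ψ : T → ℝ≥0∞ → ℝ≥0∞) {u v : T → ℝ} (h : u =ᵐ[μ] v) :
    modularReal μ Ψ u = modularReal μ Ψ v := by
  refine lintegral_congr_ae ?_
  filter_upwards [h] with t ht
  simp only [ht]

theorem MusielakOrlicz.modularReal_mono (Φ : MusielakOrlicz μ) {u v : T → ℝ}
    (h : ∀ᵐ t ∂μ, |u t| ≤ |v t|) :
    modularReal μ Φ.toFun u ≤ modularReal μ Φ.toFun v := by
  refine lintegral_mono_ae ?_
  filter_upwards [Φ.ae_isYoungFunction, h] with t ht hl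
  refine ht.mono ?_
  rw [enorm_le_iff_norm_le]
  simpa using hl

/-- The Musielak--Orlicz space `L^Φ`: all (classes of) measurable `u : T → ℝ` such that
`I_Φ(c u) < ∞` for some `c > 0`. -/
def MusielakOrlicz.space (Φ : MusielakOrlicz μ) : Submodule ℝ (T →ₘ[μ] ℝ) where
  carrier := {u | ∃ c : ℝ, 0 < c ∧ modularReal μ Φ.toFun (fun t => c * u t) < ∞}
  zero_mem' := by
    refine ⟨1, one_pos, ?_⟩
    have h0 : modularReal μ Φ.toFun (fun t => 1 * (0 : T →ₘ[μ] ℝ) t)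
        = modularReal μ Φ.toFun (fun _ => 0) :=
      modularReal_congr _ (by
        filter_upwards [AEEqFun.coeFn_zero (α := T) (β := ℝ) (μ := μ)] with t ht
        simp [ht])
    rw [h0]
    have : modularReal μ Φ.toFun (fun _ => 0) = ∫⁻ _, 0 ∂μ := by
      refine lintegral_congr_ae ?_
      filter_upwards [Φ.ae_isYoungFunction] with t ht
      simp [ht.map_zero]
    simp [this]
  add_mem' := by
    rintro u v ⟨c, hc, hu⟩ ⟨d, hd, hv⟩
    refine ⟨min c d / 2, by positivity, ?_⟩
    have hm : 0 < min c d := lt_min hc hd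
    have hle : modularReal μ Φ.toFun (fun t => min c d / 2 * (u + v : T →ₘ[μ] ℝ) t)
        ≤ ∫⁻ t, (Φ.toFun t ‖c * u t‖ₑ + Φ.toFun t ‖d * v t‖ₑ) ∂μ := by
      refine lintegral_mono_ae ?_
      filter_upwards [Φ.ae_isYoungFunction, AEEqFun.coeFn_add u v] with t ht hadd
      have h1 : ‖min c d / 2 * (u + v : T →ₘ[μ] ℝ) t‖ₑ ≤ max ‖c * u t‖ₑ ‖d * v t‖ₑ := by
        rw [hadd, le_max_iff, enorm_le_iff_norm_le, enorm_le_iff_norm_le, ← le_max_iff]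
        simp only [Pi.add_apply, norm_mul, Real.norm_eq_abs, abs_of_pos hc, abs_of_pos hd,
          abs_of_pos (half_pos hm)]
        have e1 : min c d * |u t| ≤ c * |u t| :=
          mul_le_mul_of_nonneg_right (min_le_left _ _) (abs_nonneg _)
        have e2 : min c d * |v t| ≤ d * |v t| :=
          mul_le_mul_of_nonneg_right (min_le_right _ _) (abs_nonneg _)
        have e3 : min c d * |u t + v t| ≤ min c d * (|u t| + |v t|) :=
          mul_le_mul_of_nonneg_left (abs_add_le _ _) hm.le
        have e4 := le_max_left (c * |u t|) (d * |v t|)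
        have e5 := le_max_right (c * |u t|) (d * |v t|)
        linarith
      refine (ht.mono h1).trans ?_
      rcases le_total ‖c * u t‖ₑ ‖d * v t‖ₑ with h | h
      · rw [max_eq_right h]; exact le_add_self
      · rw [max_eq_left h]; exact le_self_add
    refine hle.trans_lt ?_
    rw [lintegral_add_left' (Φ.aemeasurable
      (u.aestronglyMeasurable.aemeasurable.const_mul c).enorm)]
    exact ENNReal.add_lt_top.2 ⟨hu, hv⟩
  smul_mem' := by
    rintro a u ⟨c, hc, hu⟩
    refine ⟨c / (|a| + 1), by positivity, lt_of_le_of_lt (Φ.modularReal_mono ?_) hu⟩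
    filter_upwards [AEEqFun.coeFn_smul a u] with t ht
    rw [ht, Pi.smul_apply, smul_eq_mul, abs_mul, abs_mul, abs_mul, abs_of_pos hc,
      abs_of_pos (by positivity : 0 < c / (|a| + 1))]
    have : c / (|a| + 1) * (|a| * |u t|) = c * |u t| * (|a| / (|a| + 1)) := by
      field_simp
    rw [this]
    refine mul_le_of_le_one_right (by positivity) ?_
    rw [div_le_one (by positivity)]
    linarith

/-- The Orlicz norm
`‖u‖_{Φ,0} = sup {|∫ u v dμ| : v measurable, I_{Φ*}(v) ≤ 1}`. -/
noncomputable def MusielakOrlicz.orliczNorm (Φ : MusielakOrlicz μ) (u : T →ₘ[μ] ℝ) : ℝ :=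
  sSup {r : ℝ | ∃ v : T →ₘ[μ] ℝ, modularReal μ (complementary Φ.toFun) v ≤ 1 ∧
    r = |∫ t, u t * v t ∂μ|}

theorem MusielakOrlicz.lintegral_mul_le (Φ : MusielakOrlicz μ) (u v : T →ₘ[μ] ℝ) {c : ℝ}
    (hc : 0 < c) (hv : modularReal μ (complementary Φ.toFun) v ≤ 1) :
    ENNReal.ofReal c * ∫⁻ t, ‖u t * v t‖ₑ ∂μ
      ≤ 1 + modularReal μ Φ.toFun (fun t => c * u t) := by
  rw [← lintegral_const_mul' _ _ ENNReal.ofReal_ne_top]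
  calc ∫⁻ t, ENNReal.ofReal c * ‖u t * v t‖ₑ ∂μ
      ≤ ∫⁻ t, (complementary Φ.toFun t ‖v t‖ₑ + Φ.toFun t ‖c * u t‖ₑ) ∂μ := by
        refine lintegral_mono fun t => ?_
        have := mul_le_add_complementary Φ.toFun t (u := ‖c * u t‖ₑ) enorm_ne_top ‖v t‖ₑ
        refine le_trans (le_of_eq ?_) this
        rw [enorm_mul, enorm_mul, Real.enorm_of_nonneg hc.le, mul_assoc]
    _ = modularReal μ (complementary Φ.toFun) v + modularReal μ Φ.toFun (fun t => c * u t) := by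
        rw [lintegral_add_right' _ (Φ.aemeasurable
          (u.aestronglyMeasurable.aemeasurable.const_mul c).enorm)]
        rfl
    _ ≤ _ := by gcongr

theorem MusielakOrlicz.exists_bound (Φ : MusielakOrlicz μ) {u : T →ₘ[μ] ℝ}
    (hu : u ∈ Φ.space) : ∃ C : ℝ, ∀ v : T →ₘ[μ] ℝ,
      modularReal μ (complementary Φ.toFun) v ≤ 1 →
      Integrable (fun t => u t * v t) μ ∧ |∫ t, u t * v t ∂μ| ≤ C := by
  obtain ⟨c, hc, hfin⟩ := hu
  set M := 1 + modularReal μ Φ.toFun (fun t => c * u t) with hM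
  have hMtop : M ≠ ∞ := by simp [hM, hfin.ne]
  have hc0 : ENNReal.ofReal c ≠ 0 := by simpa using hc
  refine ⟨(M / ENNReal.ofReal c).toReal, fun v hv => ?_⟩
  have h1 : ∫⁻ t, ‖u t * v t‖ₑ ∂μ ≤ M / ENNReal.ofReal c := by
    rw [ENNReal.le_div_iff_mul_le (Or.inl hc0) (Or.inl ENNReal.ofReal_ne_top), mul_comm]
    exact Φ.lintegral_mul_le u v hc hv
  have hdiv : M / ENNReal.ofReal c ≠ ∞ := ENNReal.div_ne_top hMtop hc0
  refine ⟨⟨u.aestronglyMeasurable.mul v.aestronglyMeasurable,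
    lt_of_le_of_lt h1 hdiv.lt_top⟩, ?_⟩
  have h2 := enorm_integral_le_lintegral_enorm (μ := μ) (fun t => u t * v t)
  have h3 := ENNReal.toReal_mono hdiv (h2.trans h1)
  simpa using h3

theorem MusielakOrlicz.orliczNorm_bddAbove (Φ : MusielakOrlicz μ) {u : T →ₘ[μ] ℝ}
    (hu : u ∈ Φ.space) :
    BddAbove {r : ℝ | ∃ v : T →ₘ[μ] ℝ, modularReal μ (complementary Φ.toFun) v ≤ 1 ∧
      r = |∫ t, u t * v t ∂μ|} := by
  obtain ⟨C, hC⟩ := Φ.exists_bound hu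
  exact ⟨C, by rintro _ ⟨v, hv, rfl⟩; exact (hC v hv).2⟩

theorem MusielakOrlicz.orliczNorm_nonempty (Φ : MusielakOrlicz μ) (u : T →ₘ[μ] ℝ) :
    {r : ℝ | ∃ v : T →ₘ[μ] ℝ, modularReal μ (complementary Φ.toFun) v ≤ 1 ∧
      r = |∫ t, u t * v t ∂μ|}.Nonempty := by
  refine ⟨_, 0, ?_, rfl⟩
  rw [modularReal_congr _ (AEEqFun.coeFn_zero (α := T) (β := ℝ) (μ := μ))]
  simp [modularReal, modular, complementary_zero]

theorem MusielakOrlicz.orliczNorm_nonneg (Φ : MusielakOrlicz μ) (u : T →ₘ[μ] ℝ) :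
    0 ≤ Φ.orliczNorm u :=
  Real.sSup_nonneg (by rintro _ ⟨v, -, rfl⟩; exact abs_nonneg _)

theorem MusielakOrlicz.orliczNorm_smul (Φ : MusielakOrlicz μ) (a : ℝ) (u : T →ₘ[μ] ℝ) :
    Φ.orliczNorm (a • u) = |a| * Φ.orliczNorm u := by
  have key : {r : ℝ | ∃ v : T →ₘ[μ] ℝ, modularReal μ (complementary Φ.toFun) v ≤ 1 ∧
      r = |∫ t, (a • u : T →ₘ[μ] ℝ) t * v t ∂μ|} =
      (|a|) • {r : ℝ | ∃ v : T →ₘ[μ] ℝ, modularReal μ (complementary Φ.toFun) v ≤ 1 ∧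
      r = |∫ t, u t * v t ∂μ|} := by
    have hint : ∀ v : T →ₘ[μ] ℝ, |∫ t, (a • u : T →ₘ[μ] ℝ) t * v t ∂μ|
        = |a| * |∫ t, u t * v t ∂μ| := by
      intro v
      rw [← abs_mul, ← integral_const_mul]
      congr 1
      refine integral_congr_ae ?_
      filter_upwards [AEEqFun.coeFn_smul a u] with t ht
      simp [ht, mul_assoc]
    ext r
    simp only [mem_smul_set, mem_ofPred_eq, smul_eq_mul]
    constructor
    · rintro ⟨v, hv, rfl⟩
      exact ⟨_, ⟨v, hv, rfl⟩, (hint v).symm⟩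
    · rintro ⟨_, ⟨v, hv, rfl⟩, rfl⟩
      exact ⟨v, hv, (hint v).symm⟩
  rw [MusielakOrlicz.orliczNorm, key, Real.sSup_smul_of_nonneg (abs_nonneg a), smul_eq_mul]
  rfl

theorem MusielakOrlicz.orliczNorm_add_le (Φ : MusielakOrlicz μ) {u w : T →ₘ[μ] ℝ}
    (hu : u ∈ Φ.space) (hw : w ∈ Φ.space) :
    Φ.orliczNorm (u + w) ≤ Φ.orliczNorm u + Φ.orliczNorm w := by
  refine csSup_le (Φ.orliczNorm_nonempty _) ?_
  rintro _ ⟨v, hv, rfl⟩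
  obtain ⟨_, hC⟩ := Φ.exists_bound hu
  obtain ⟨_, hD⟩ := Φ.exists_bound hw
  have h : ∫ t, (u + w : T →ₘ[μ] ℝ) t * v t ∂μ
      = ∫ t, u t * v t ∂μ + ∫ t, w t * v t ∂μ := by
    rw [← integral_add (hC v hv).1 (hD v hv).1]
    refine integral_congr_ae ?_
    filter_upwards [AEEqFun.coeFn_add u w] with t ht
    simp [ht, add_mul]
  rw [h]
  exact (abs_add_le _ _).trans (add_le_add
    (le_csSup (Φ.orliczNorm_bddAbove hu) ⟨v, hv, rfl⟩)
    (le_csSup (Φ.orliczNorm_bddAbove hw) ⟨v, hv, rfl⟩))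

theorem MusielakOrlicz.eq_zero_of_orliczNorm_eq_zero [SigmaFinite μ] (Φ : MusielakOrlicz μ)
    {u : T →ₘ[μ] ℝ} (hu : u ∈ Φ.space) (h0 : Φ.orliczNorm u = 0) : u = 0 := by
  have hum : Measurable (u : T → ℝ) := u.stronglyMeasurable.measurable
  have key : ∀ n m : ℕ, μ ({t | 1 ≤ Φ.toFun t (n + 1 : ℕ)} ∩ spanningSets μ m ∩ {t | u t ≠ 0})
      = 0 := by
    intro n m
    set B := {t | 1 ≤ Φ.toFun t (n + 1 : ℕ)} ∩ spanningSets μ m ∩ {t | u t ≠ 0} with hB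
    have hBm : MeasurableSet B := by
      refine ((measurableSet_le measurable_const (Φ.measurable _)).inter
        (measurableSet_spanningSets μ m)).inter ?_
      exact (measurableSet_eq_fun hum measurable_const).compl
    have hBfin : μ B < ∞ :=
      lt_of_le_of_lt (measure_mono (inter_subset_left.trans inter_subset_right))
        (measure_spanningSets_lt_top μ m)
    obtain ⟨k, hk⟩ := ENNReal.exists_nat_gt hBfin.ne
    set c : ℝ := ((n + 1 : ℕ) : ℝ)⁻¹ * ((k + 1 : ℕ) : ℝ)⁻¹ with hc
    have hcpos : 0 < c := by positivity
    have hce : ‖c‖ₑ = ((n + 1 : ℕ) : ℝ≥0∞)⁻¹ * ((k + 1 : ℕ) : ℝ≥0∞)⁻¹ := by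
      rw [Real.enorm_of_nonneg hcpos.le, hc, ENNReal.ofReal_mul (by positivity),
        ENNReal.ofReal_inv_of_pos (by positivity), ENNReal.ofReal_inv_of_pos (by positivity),
        ENNReal.ofReal_natCast, ENNReal.ofReal_natCast]
    set g : T → ℝ := B.indicator fun t => c * SignType.sign (u t) with hg
    have hgm : Measurable g := by
      refine Measurable.indicator ?_ hBm
      refine measurable_const.mul ?_
      have hs : (fun t => ((SignType.sign (u t) : SignType) : ℝ))
          = fun t => if 0 < u t then (1 : ℝ) else if u t < 0 then -1 else 0 := by
        funext t
        rw [sign_apply]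
        split_ifs <;> simp
      rw [hs]
      exact Measurable.ite (measurableSet_lt measurable_const hum) measurable_const
        (Measurable.ite (measurableSet_lt hum measurable_const) measurable_const measurable_const)
    set v : T →ₘ[μ] ℝ := AEEqFun.mk g hgm.aestronglyMeasurable with hv
    have hvg : v =ᵐ[μ] g := AEEqFun.coeFn_mk _ _
    have hmod : modularReal μ (complementary Φ.toFun) v ≤ 1 := by
      rw [modularReal_congr _ hvg]
      calc modularReal μ (complementary Φ.toFun) g
          ≤ ∫⁻ t, B.indicator (fun _ => ((k + 1 : ℕ) : ℝ≥0∞)⁻¹) t ∂μ := by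
            refine lintegral_mono_ae ?_
            filter_upwards [Φ.ae_isYoungFunction] with t ht
            by_cases htB : t ∈ B
            · have hsgn : ‖g t‖ₑ = ‖c‖ₑ := by
                have h1 : u t ≠ 0 := htB.2
                rw [hg, indicator_of_mem htB, enorm_mul]
                rcases lt_or_gt_of_ne h1 with h | h
                · simp [sign_neg h]
                · simp [sign_pos h]
              rw [indicator_of_mem htB, hsgn, hce]
              exact complementary_le_of_one_le ht htB.1.1
            · simp [hg, indicator_of_notMem htB, complementary_zero]
        _ = ((k + 1 : ℕ) : ℝ≥0∞)⁻¹ * μ B := by rw [lintegral_indicator_const hBm]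
        _ ≤ ((k + 1 : ℕ) : ℝ≥0∞)⁻¹ * ((k + 1 : ℕ) : ℝ≥0∞) := by
            gcongr
            refine hk.le.trans ?_
            exact_mod_cast Nat.le_succ k
        _ ≤ 1 := ENNReal.inv_mul_le_one _
    obtain ⟨_, hC⟩ := Φ.exists_bound hu
    have hint0 : ∫ t, u t * v t ∂μ = 0 := by
      have hle : |∫ t, u t * v t ∂μ| ≤ Φ.orliczNorm u :=
        le_csSup (Φ.orliczNorm_bddAbove hu) ⟨v, hmod, rfl⟩
      rw [h0] at hle
      exact abs_nonpos_iff.1 hle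
    have heq : (fun t => u t * v t) =ᵐ[μ] B.indicator fun t => c * |u t| := by
      filter_upwards [hvg] with t ht
      rw [ht]
      by_cases htB : t ∈ B
      · rw [hg, indicator_of_mem htB, indicator_of_mem htB, mul_left_comm, self_mul_sign]
      · simp [hg, indicator_of_notMem htB]
    have hi := (hC v hmod).1.congr heq
    rw [integral_congr_ae heq] at hint0
    have hz := (integral_eq_zero_iff_of_nonneg
      (fun t => indicator_nonneg (fun t _ => by positivity) t) hi).1 hint0
    rw [measure_eq_zero_iff_ae_notMem]
    filter_upwards [hz] with t ht htB
    rw [indicator_of_mem htB] at ht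
    have : u t ≠ 0 := htB.2
    have h3 : 0 < c * |u t| := by positivity
    exact h3.ne' ht
  have hall : ∀ᵐ t ∂μ, ∀ n m : ℕ,
      t ∉ {t | 1 ≤ Φ.toFun t (n + 1 : ℕ)} ∩ spanningSets μ m ∩ {t | u t ≠ 0} :=
    ae_all_iff.2 fun n => ae_all_iff.2 fun m => measure_eq_zero_iff_ae_notMem.1 (key n m)
  refine AEEqFun.ext ?_
  filter_upwards [hall, Φ.ae_isYoungFunction,
    AEEqFun.coeFn_zero (α := T) (β := ℝ) (μ := μ)] with t ht hY hzero
  rw [hzero]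
  by_contra hne
  obtain ⟨n, hn⟩ := hY.exists_one_le
  obtain ⟨m, hm⟩ : ∃ m, t ∈ spanningSets μ m := by
    have := mem_univ t
    rwa [← iUnion_spanningSets μ, mem_iUnion] at this
  exact ht n m ⟨⟨hn, hm⟩, hne⟩

noncomputable instance MusielakOrlicz.instNorm (Φ : MusielakOrlicz μ) : Norm Φ.space where
  norm u := Φ.orliczNorm (u : T →ₘ[μ] ℝ)

theorem MusielakOrlicz.norm_def (Φ : MusielakOrlicz μ) (u : Φ.space) :
    ‖u‖ = Φ.orliczNorm (u : T →ₘ[μ] ℝ) := rfl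

theorem MusielakOrlicz.normedSpaceCore [SigmaFinite μ] (Φ : MusielakOrlicz μ) :
    NormedSpace.Core ℝ Φ.space where
  norm_nonneg u := Φ.orliczNorm_nonneg _
  norm_smul a u := Φ.orliczNorm_smul a _
  norm_triangle u w := Φ.orliczNorm_add_le u.2 w.2
  norm_eq_zero_iff u := by
    refine ⟨fun h => Subtype.ext (Φ.eq_zero_of_orliczNorm_eq_zero u.2 h), ?_⟩
    rintro rfl
    have h := Φ.orliczNorm_smul 0 (0 : T →ₘ[μ] ℝ)
    rw [smul_zero, abs_zero, zero_mul] at h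
    exact h

/-- `L_0^Φ`: the space `L^Φ` with the Orlicz norm. -/
noncomputable instance MusielakOrlicz.instNormedAddCommGroup [SigmaFinite μ]
    (Φ : MusielakOrlicz μ) : NormedAddCommGroup Φ.space :=
  NormedAddCommGroup.ofCore Φ.normedSpaceCore

noncomputable instance MusielakOrlicz.instNormedSpace [SigmaFinite μ]
    (Φ : MusielakOrlicz μ) : NormedSpace ℝ Φ.space :=
  NormedSpace.ofCore Φ.normedSpaceCore

/-- The quantity `(1 + I_Φ(k u)) / k`. -/
noncomputable def MusielakOrlicz.amemiya (Φ : MusielakOrlicz μ) (u : T →ₘ[μ] ℝ) (k : ℝ) : ℝ≥0∞ :=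
  (1 + modularReal μ Φ.toFun fun t => k * u t) / ENNReal.ofReal k

/-- `K(u)`: the set of all `k > 0` at which the infimum `inf_{k > 0} (1 + I_Φ(k u)) / k`
is attained. -/
def MusielakOrlicz.K (Φ : MusielakOrlicz μ) (u : T →ₘ[μ] ℝ) : Set ℝ :=
  {k : ℝ | 0 < k ∧ Φ.amemiya u k = ⨅ (l : ℝ) (_ : 0 < l), Φ.amemiya u l}

end Space

/-- A support functional at `x`: a bounded linear functional of norm one with `f x = ‖x‖`. -/
def IsSupportFunctional {X : Type*} [NormedAddCommGroup X] [NormedSpace ℝ X] (x : X)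
    (f : X →L[ℝ] ℝ) : Prop :=
  ‖f‖ = 1 ∧ f x = ‖x‖

/-- `x ≠ 0` is a smooth point if there is exactly one support functional at `x`. -/
def IsSmoothPoint {X : Type*} [NormedAddCommGroup X] [NormedSpace ℝ X] (x : X) : Prop :=
  x ≠ 0 ∧ ∃! f : X →L[ℝ] ℝ, IsSupportFunctional x f

/-! Write b for `bFun` of the complementary function Φ*, S for the support of u, and α for the
modular of bχ_S under Φ*. Pointwise, b(t) is the asymptotic slope of Φ(t, ·), so I_Φ(ku)/k increases
to ∫|u|b as k → ∞. The quotient (1 + I_Φ(ku))/k is lower semicontinuous in k and at least 1/k, so if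
its infimum is not attained, near-minimizers lie beyond every bound. Hence ∫|u|b is at most the
infimum and is finite; in particular b is finite on S.

The functions n|u|b − Φ(·, n|u|) increase with n, and on S their supremum dominates Φ*(·, b). Thus α
≤ 1 (`modular_indicator_bFun_le_one`). Therefore v = b sgn u is admissible in the Orlicz norm, ‖u‖ =
∫|u|b, and v induces a support functional.

Uniqueness rests on one-sided difference quotients of the norm at u. In a direction x carried by S,
the norm is bounded by ∫|u + sx|b, whose derivative at s = 0 is ∫xv; every support functional agrees
with v there (`support_apply_le_of_support_subset`). In a direction carried by the complement of S,
suppose α = 1 and `aFun` of Φ* vanishes off S. Then 1 + I_Φ(ku) can be brought arbitrarily close to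
k‖u‖, while I_Φ(lx)/l is small for small l, so the difference quotients can be made arbitrarily
small (`support_apply_nonpos_of_disjoint_support`). If the complement of S is null, no such
directions remain.

Conversely, suppose a function cχ_B with c > 0 and B a non-null set off S can be added to v without
the modular exceeding 1. Then v + cχ_B gives a second support functional
(`not_isSmoothPoint_of_setLIntegral_le`). This is possible when α < 1 and the complement of S is not
null, and also when `aFun` of Φ* is nonzero on a non-null set off S. -/

theorem ENNReal.exists_nnrat_btwn {a b : ℝ≥0∞} (h : a < b) :
    ∃ q : ℚ≥0, a < ((q : ℝ≥0) : ℝ≥0∞) ∧ ((q : ℝ≥0) : ℝ≥0∞) < b := by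
  obtain ⟨q, hq0, hq1, hq2⟩ := ENNReal.lt_iff_exists_rat_btwn.1 h
  lift q to ℚ≥0 using hq0
  have hcast : ((Real.toNNReal ((q : ℚ) : ℝ) : ℝ≥0) : ℝ≥0∞) = ((q : ℝ≥0) : ℝ≥0∞) := by
    congr 1
    ext
    rw [Real.coe_toNNReal _ (by positivity)]
    simp only [Rat.cast_nnratCast]
    exact (map_nnratCast NNReal.toRealHom q).symm
  rw [hcast] at hq1 hq2
  exact ⟨q, hq1, hq2⟩

/-! ### Pointwise convexity: the slopes of Φ(t, ·) at infinity and at zero. -/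

section Pointwise

variable {T : Type*} {Φ : T → ℝ≥0∞ → ℝ≥0∞} {t : T}

/-- Lowering u slightly to a rational decreases Φ(t, u) and costs little in uv, so monotonicity
suffices. The countable supremum is what gives measurability of the complementary function. -/
theorem IsYoungFunction.complementary_eq_iSup_rat (h : IsYoungFunction (Φ t)) (v : ℝ≥0∞) :
    complementary Φ t v
      = ⨆ q : ℚ≥0, ((q : ℝ≥0) : ℝ≥0∞) * v - Φ t ((q : ℝ≥0) : ℝ≥0∞) := by
  apply le_antisymm
  · refine iSup₂_le fun u hu => le_of_forall_lt fun c hc => ?_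
    have h1 : c + Φ t u < u * v := lt_tsub_iff_right.1 hc
    have hv : v ≠ 0 := by rintro rfl; simp at h1
    have hct : c + Φ t u ≠ ∞ := ne_top_of_lt h1
    have h2 : (c + Φ t u) / v < u := ENNReal.div_lt_of_lt_mul h1
    obtain ⟨q, hq1, hq2⟩ := ENNReal.exists_nnrat_btwn h2
    refine lt_of_lt_of_le ?_ (le_iSup _ q)
    rw [lt_tsub_iff_right]
    have h3 : c + Φ t u < (q : ℝ≥0) * v := by
      exact (ENNReal.div_lt_iff (Or.inl hv) (Or.inr hct)).1 hq1
    refine lt_of_le_of_lt ?_ h3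
    gcongr
    exact h.mono hq2.le
  · refine iSup_le fun q => ?_
    rcases eq_or_ne q 0 with rfl | hq
    · simp
    · exact le_iSup₂_of_le (q : ℝ≥0) (by positivity) le_rfl

theorem complementary_mono (Φ : T → ℝ≥0∞ → ℝ≥0∞) (t : T) : Monotone (complementary Φ t) := by
  intro v w h
  unfold complementary
  gcongr

theorem le_bFun {v : ℝ≥0∞} (h : Φ t v ≠ ∞) : v ≤ bFun Φ t := le_sSup h.lt_top

theorem IsYoungFunction.div_le_div (h : IsYoungFunction (Φ t)) {r s x : ℝ≥0∞} (hr : r ≠ 0)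
    (hrs : r ≤ s) (hs : s ≠ ∞) : Φ t (r * x) / r ≤ Φ t (s * x) / s := by
  have hrt : r ≠ ∞ := ne_top_of_le_ne_top hs hrs
  have hs0 : s ≠ 0 := (hr.bot_lt.trans_le hrs).ne'
  have hct : r / s ≠ ∞ := ENNReal.div_ne_top hrt hs0
  have h1 : (r / s).toNNReal ≤ 1 := by
    rw [← ENNReal.coe_le_coe, ENNReal.coe_toNNReal hct]
    exact ENNReal.div_le_of_le_mul (by simpa using hrs)
  have h2 := h.map_mul_le h1 (s * x)
  rw [ENNReal.coe_toNNReal hct, ← mul_assoc, ENNReal.div_mul_cancel hs0 hs] at h2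
  refine ENNReal.div_le_of_le_mul (h2.trans (le_of_eq ?_))
  rw [ENNReal.div_eq_inv_mul, ENNReal.div_eq_inv_mul]
  ring

/-- If d < Φ(t, s)/s, then Φ*(t, d) ≤ sd. For u ≤ s the term ud already obeys this; for u ≥ s the
quotient Φ(t, u)/u exceeds d and the truncated difference vanishes. So every such d lies below b. -/
theorem IsYoungFunction.le_mul_bFun (h : IsYoungFunction (Φ t)) {s : ℝ≥0∞} (hs : s ≠ ∞) :
    Φ t s ≤ s * bFun (complementary Φ) t := by
  rcases eq_or_ne s 0 with rfl | hs0
  · simp [h.map_zero]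
  rw [mul_comm, ← ENNReal.div_le_iff_le_mul (Or.inl hs0) (Or.inl hs)]
  refine le_of_forall_lt fun c hc => ?_
  obtain ⟨d, hcd, hd⟩ := exists_between hc
  refine hcd.trans_le (le_bFun (ne_top_of_le_ne_top (ENNReal.mul_ne_top hs (ne_top_of_lt hd))
    (?_ : _ ≤ s * d)))
  refine iSup₂_le fun u hu => ?_
  rcases le_total (u : ℝ≥0∞) s with hus | hus
  · exact tsub_le_self.trans (by gcongr)
  · have h1 := h.div_le_div (x := 1) hs0 hus ENNReal.coe_ne_top
    rw [mul_one, mul_one] at h1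
    have h2 := hd.le.trans h1
    rw [ENNReal.le_div_iff_mul_le (Or.inl (by simpa using hu.ne')) (Or.inl ENNReal.coe_ne_top),
      mul_comm] at h2
    rw [tsub_eq_zero_of_le h2]
    exact zero_le

/-- Here b appears as the asymptotic slope of Φ(t, ·). For Φ*(t, v) < ∞, Young's inequality at ns
divided by n gives sv ≤ Φ*(t, v)/n + Φ(t, ns)/n, and the first term tends to zero. -/
theorem IsYoungFunction.mul_bFun_eq_iSup (h : IsYoungFunction (Φ t)) {s : ℝ≥0∞} (hs : s ≠ ∞) :
    s * bFun (complementary Φ) t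
      = ⨆ n : ℕ, Φ t (((n + 1 : ℕ) : ℝ≥0∞) * s) / ((n + 1 : ℕ) : ℝ≥0∞) := by
  apply le_antisymm
  · rw [bFun, ENNReal.mul_sSup]
    refine iSup₂_le fun v hv => ?_
    set M := ⨆ n : ℕ, Φ t (((n + 1 : ℕ) : ℝ≥0∞) * s) / ((n + 1 : ℕ) : ℝ≥0∞) with hM
    have hv : complementary Φ t v ≠ ∞ := ne_of_lt hv
    have key : ∀ n : ℕ, s * v ≤ complementary Φ t v * ((n + 1 : ℕ) : ℝ≥0∞)⁻¹ + M := by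
      intro n
      have hn : ((n + 1 : ℕ) : ℝ≥0∞) ≠ 0 := by simp
      have hnt : ((n + 1 : ℕ) : ℝ≥0∞) ≠ ∞ := ENNReal.natCast_ne_top _
      have h1 := mul_le_add_complementary Φ t (ENNReal.mul_ne_top hnt hs) v
      have h2 : s * v ≤ (complementary Φ t v + Φ t (((n + 1 : ℕ) : ℝ≥0∞) * s))
          / ((n + 1 : ℕ) : ℝ≥0∞) := by
        rw [ENNReal.le_div_iff_mul_le (Or.inl hn) (Or.inl hnt)]
        refine le_trans (le_of_eq (by ring)) h1
      rw [ENNReal.add_div] at h2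
      refine h2.trans ?_
      rw [ENNReal.div_eq_inv_mul, mul_comm]
      gcongr
      exact le_iSup (fun n : ℕ => Φ t (((n + 1 : ℕ) : ℝ≥0∞) * s) / ((n + 1 : ℕ) : ℝ≥0∞)) n
    have hlim : Tendsto (fun n : ℕ => complementary Φ t v * ((n + 1 : ℕ) : ℝ≥0∞)⁻¹ + M) atTop
        (𝓝 (complementary Φ t v * 0 + M)) :=
      (ENNReal.Tendsto.const_mul
        (ENNReal.tendsto_inv_nat_nhds_zero.comp (tendsto_add_atTop_nat 1)) (Or.inr hv)).add_const M
    simpa using ge_of_tendsto' hlim key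
  · refine iSup_le fun n => ENNReal.div_le_of_le_mul ?_
    refine (h.le_mul_bFun (ENNReal.mul_ne_top (ENNReal.natCast_ne_top _) hs)).trans
      (le_of_eq (by ring))

/-- A convex function has increments bounded by its asymptotic slope. The point r + d is a convex
combination of r and r + nd with weight 1/n on the far point, where Φ is bounded linearly by b; the
excess rb/n vanishes in the limit. -/
theorem IsYoungFunction.add_le_add_mul_bFun (h : IsYoungFunction (Φ t)) {r d : ℝ≥0∞} (hr : r ≠ ∞)
    (hd : d ≠ ∞) (hb : bFun (complementary Φ) t ≠ ∞) :
    Φ t (r + d) ≤ Φ t r + d * bFun (complementary Φ) t := by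
  set b := bFun (complementary Φ) t
  have key : ∀ n : ℕ, Φ t (r + d) ≤ (Φ t r + d * b) + r * b * ((n + 1 : ℕ) : ℝ≥0∞)⁻¹ := by
    intro n
    set l : ℝ≥0 := ((n + 1 : ℕ) : ℝ≥0)⁻¹ with hl
    have hl1 : l ≤ 1 := by
      rw [hl]; exact inv_le_one_of_one_le₀ (by exact_mod_cast Nat.le_add_left 1 n)
    have hlc : ((n + 1 : ℕ) : ℝ≥0∞)⁻¹ = (l : ℝ≥0∞) := by
      rw [hl, ENNReal.coe_inv (by positivity)]; simp
    have hln : (l : ℝ≥0∞) * ((n + 1 : ℕ) : ℝ≥0∞) = 1 := by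
      rw [← hlc]; exact ENNReal.inv_mul_cancel (by simp) (ENNReal.natCast_ne_top _)
    have hsum : ((1 - l : ℝ≥0) : ℝ≥0∞) + l = 1 := by
      rw [← ENNReal.coe_add, tsub_add_cancel_of_le hl1]; simp
    have h1 := h.convexOn.2 (mem_univ r) (mem_univ (r + ((n + 1 : ℕ) : ℝ≥0∞) * d))
      (zero_le : 0 ≤ 1 - l) (zero_le : 0 ≤ l) (tsub_add_cancel_of_le hl1)
    simp only [ENNReal.smul_def, smul_eq_mul] at h1
    have e1 : ((1 - l : ℝ≥0) : ℝ≥0∞) * r + l * (r + ((n + 1 : ℕ) : ℝ≥0∞) * d) = r + d := by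
      calc _ = (((1 - l : ℝ≥0) : ℝ≥0∞) + l) * r + (l * ((n + 1 : ℕ) : ℝ≥0∞)) * d := by ring
        _ = _ := by rw [hsum, hln, one_mul, one_mul]
    rw [e1] at h1
    refine h1.trans ?_
    have h2 := h.le_mul_bFun (s := r + ((n + 1 : ℕ) : ℝ≥0∞) * d)
      (ENNReal.add_ne_top.2 ⟨hr, ENNReal.mul_ne_top (ENNReal.natCast_ne_top _) hd⟩)
    calc ((1 - l : ℝ≥0) : ℝ≥0∞) * Φ t r + l * Φ t (r + ((n + 1 : ℕ) : ℝ≥0∞) * d)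
        ≤ 1 * Φ t r + l * ((r + ((n + 1 : ℕ) : ℝ≥0∞) * d) * b) := by
          gcongr
          exact hsum ▸ le_self_add
      _ = Φ t r + (l * ((n + 1 : ℕ) : ℝ≥0∞)) * d * b + r * b * l := by ring
      _ = _ := by rw [hln, hlc, one_mul]
  have hlim : Tendsto (fun n : ℕ => (Φ t r + d * b) + r * b * ((n + 1 : ℕ) : ℝ≥0∞)⁻¹) atTop
      (𝓝 ((Φ t r + d * b) + r * b * 0)) :=
    (ENNReal.Tendsto.const_mul (ENNReal.tendsto_inv_nat_nhds_zero.comp (tendsto_add_atTop_nat 1))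
      (Or.inr (ENNReal.mul_ne_top hr hb))).const_add _
  simpa using ge_of_tendsto' hlim key

theorem IsYoungFunction.mul_bFun_sub_mono (h : IsYoungFunction (Φ t))
    (hb : bFun (complementary Φ) t ≠ ∞) {r s : ℝ≥0∞} (hrs : r ≤ s) (hs : s ≠ ∞) :
    r * bFun (complementary Φ) t - Φ t r ≤ s * bFun (complementary Φ) t - Φ t s := by
  set b := bFun (complementary Φ) t
  obtain ⟨d, rfl⟩ := exists_add_of_le hrs
  obtain ⟨hr, hd⟩ := ENNReal.add_ne_top.1 hs
  have h1 : Φ t (r + d) ≤ (r + d) * b := h.le_mul_bFun hs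
  have h2 := h.add_le_add_mul_bFun hr hd hb
  rw [tsub_le_iff_right]
  refine ENNReal.le_of_add_le_add_right (ENNReal.mul_ne_top hd hb) ?_
  calc r * b + d * b = (r + d) * b := by ring
    _ = ((r + d) * b - Φ t (r + d)) + Φ t (r + d) := (tsub_add_cancel_of_le h1).symm
    _ ≤ ((r + d) * b - Φ t (r + d)) + (Φ t r + d * b) := by gcongr
    _ = _ := by rw [add_assoc]

/-- At v = b the map u ↦ ub − Φ(t, u) is nondecreasing, so the defining supremum may be taken along
the multiples of any single s. Taking s = |x(t)| later turns it into a limit along nx. -/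
theorem IsYoungFunction.complementary_bFun_le_iSup (h : IsYoungFunction (Φ t))
    (hb : bFun (complementary Φ) t ≠ ∞) {s : ℝ≥0∞} (hs0 : s ≠ 0) (hs : s ≠ ∞) :
    complementary Φ t (bFun (complementary Φ) t)
      ≤ ⨆ n : ℕ, ((n + 1 : ℕ) : ℝ≥0∞) * s * bFun (complementary Φ) t
          - Φ t (((n + 1 : ℕ) : ℝ≥0∞) * s) := by
  refine iSup₂_le fun u hu => ?_
  obtain ⟨n, hn⟩ := ENNReal.exists_nat_gt (ENNReal.div_ne_top (ENNReal.coe_ne_top (r := u)) hs0)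
  refine le_trans (h.mul_bFun_sub_mono hb ?_
    (ENNReal.mul_ne_top (ENNReal.natCast_ne_top (n + 1)) hs)) (le_iSup_of_le n le_rfl)
  rw [ENNReal.div_lt_iff (Or.inl hs0) (Or.inl hs)] at hn
  refine hn.le.trans ?_
  gcongr
  exact Nat.le_succ n

/-- The condition says that Φ(t, ·) has slope zero at the origin: if Φ(t, u) ≥ uc held for all u > 0
with some c > 0, then Φ*(t, c) = 0. Monotonicity of Φ(t, u)/u carries smallness at one u to all
smaller arguments. -/
theorem IsYoungFunction.tendsto_div_zero_of_aFun_eq_zero (h : IsYoungFunction (Φ t))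
    (ha : aFun (complementary Φ) t = 0) {s : ℝ≥0∞} (hs : s ≠ ∞) :
    Tendsto (fun n : ℕ => ((n + 1 : ℕ) : ℝ≥0∞) * Φ t (((n + 1 : ℕ) : ℝ≥0∞)⁻¹ * s)) atTop (𝓝 0) := by
  have key : ∀ c : ℝ≥0∞, c ≠ 0 → ∃ u : ℝ≥0, 0 < u ∧ Φ t u < u * c := by
    intro c hc
    by_contra! hcon
    have h0 : complementary Φ t c = 0 := by
      refine le_zero_iff.1 (iSup₂_le fun u hu => ?_)
      rw [tsub_eq_zero_of_le (hcon u hu)]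
    have : c ≤ aFun (complementary Φ) t := le_sSup h0
    rw [ha] at this
    exact hc (le_zero_iff.1 this)
  rw [ENNReal.tendsto_nhds_zero]
  intro ε hε
  rcases eq_or_ne s 0 with rfl | hs0
  · simp [h.map_zero]
  obtain ⟨u, hu, huc⟩ := key (ε / s) (ENNReal.div_ne_zero.2 ⟨hε.ne', hs⟩)
  have hu0 : (u : ℝ≥0∞) ≠ 0 := by simpa using hu.ne'
  have hlim : Tendsto (fun n : ℕ => ((n + 1 : ℕ) : ℝ≥0∞)⁻¹ * s) atTop (𝓝 (0 * s)) :=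
    ENNReal.Tendsto.mul_const (ENNReal.tendsto_inv_nat_nhds_zero.comp (tendsto_add_atTop_nat 1))
      (Or.inr hs)
  rw [zero_mul] at hlim
  filter_upwards [hlim.eventually_lt_const (pos_iff_ne_zero.2 hu0)] with n hn
  have hn0 : ((n + 1 : ℕ) : ℝ≥0∞) ≠ 0 := by simp
  have hnt : ((n + 1 : ℕ) : ℝ≥0∞) ≠ ∞ := ENNReal.natCast_ne_top _
  have hr0 : ((n + 1 : ℕ) : ℝ≥0∞)⁻¹ * s ≠ 0 := mul_ne_zero (ENNReal.inv_ne_zero.2 hnt) hs0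
  have h1 := h.div_le_div (x := 1) hr0 hn.le ENNReal.coe_ne_top
  rw [mul_one, mul_one] at h1
  have h2 : Φ t (u : ℝ≥0∞) / u ≤ ε / s := by
    refine ENNReal.div_le_of_le_mul (huc.le.trans (le_of_eq (mul_comm _ _)))
  have h3 := (ENNReal.div_le_iff hr0 (ne_top_of_lt hn)).1 (h1.trans h2)
  calc ((n + 1 : ℕ) : ℝ≥0∞) * Φ t (((n + 1 : ℕ) : ℝ≥0∞)⁻¹ * s)
      ≤ ((n + 1 : ℕ) : ℝ≥0∞) * (ε / s * (((n + 1 : ℕ) : ℝ≥0∞)⁻¹ * s)) := by gcongr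
    _ = (((n + 1 : ℕ) : ℝ≥0∞) * ((n + 1 : ℕ) : ℝ≥0∞)⁻¹) * (ε / s * s) := by ring
    _ = ε := by
      rw [ENNReal.mul_inv_cancel hn0 hnt, ENNReal.div_mul_cancel hs0 hs, one_mul]

end Pointwise

/-! ### Measurability and the behaviour of I_Φ(kx) in k. -/

namespace MusielakOrlicz

variable {T : Type*} [MeasurableSpace T] {μ : Measure T} (Φ : MusielakOrlicz μ)

theorem aemeasurable_bFun : AEMeasurable (bFun (complementary Φ.toFun)) μ := by
  have key : Measurable fun t => ⨆ n : ℕ, Φ.toFun t ((n + 1 : ℕ) : ℝ≥0∞) / ((n + 1 : ℕ) : ℝ≥0∞) :=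
    Measurable.iSup fun n => (Φ.measurable _).div_const _
  refine key.aemeasurable.congr ?_
  filter_upwards [Φ.ae_isYoungFunction] with t ht
  have := ht.mul_bFun_eq_iSup (s := 1) ENNReal.one_ne_top
  simpa using this.symm

theorem aemeasurable_complementary {w : T → ℝ≥0∞} (hw : AEMeasurable w μ) :
    AEMeasurable (fun t => complementary Φ.toFun t (w t)) μ := by
  have key : AEMeasurable (fun t => ⨆ q : ℚ≥0,
      ((q : ℝ≥0) : ℝ≥0∞) * w t - Φ.toFun t ((q : ℝ≥0) : ℝ≥0∞)) μ :=
    AEMeasurable.iSup fun q => (hw.const_mul _).sub (Φ.measurable _).aemeasurable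
  refine key.congr ?_
  filter_upwards [Φ.ae_isYoungFunction] with t ht
  rw [ht.complementary_eq_iSup_rat]

theorem aemeasurable_const_mul (x : T →ₘ[μ] ℝ) (k : ℝ) :
    AEMeasurable (fun t => Φ.toFun t ‖k * x t‖ₑ) μ :=
  Φ.aemeasurable (x.aestronglyMeasurable.aemeasurable.const_mul k).enorm

theorem modularReal_div_mono (x : T →ₘ[μ] ℝ) {k l : ℝ} (hk : 0 < k) (hkl : k ≤ l) :
    modularReal μ Φ.toFun (fun t => k * x t) / ENNReal.ofReal k
      ≤ modularReal μ Φ.toFun (fun t => l * x t) / ENNReal.ofReal l := by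
  have hl : 0 < l := hk.trans_le hkl
  simp only [modularReal, modular, div_eq_mul_inv]
  rw [← lintegral_mul_const' _ _ (by simpa using hk), ← lintegral_mul_const' _ _ (by simpa using hl)]
  refine lintegral_mono_ae ?_
  filter_upwards [Φ.ae_isYoungFunction] with t ht
  rw [enorm_mul, enorm_mul, Real.enorm_of_nonneg hk.le, Real.enorm_of_nonneg hl.le,
    ← div_eq_mul_inv, ← div_eq_mul_inv]
  exact ht.div_le_div (by simpa using hk) (ENNReal.ofReal_le_ofReal hkl) ENNReal.ofReal_ne_top

theorem lintegral_mul_bFun_eq_iSup (x : T →ₘ[μ] ℝ) :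
    ∫⁻ t, ‖x t‖ₑ * bFun (complementary Φ.toFun) t ∂μ
      = ⨆ n : ℕ, modularReal μ Φ.toFun (fun t => ((n + 1 : ℕ) : ℝ) * x t)
          / ENNReal.ofReal ((n + 1 : ℕ) : ℝ) := by
  have h1 : ∫⁻ t, ‖x t‖ₑ * bFun (complementary Φ.toFun) t ∂μ
      = ∫⁻ t, ⨆ n : ℕ, Φ.toFun t ‖((n + 1 : ℕ) : ℝ) * x t‖ₑ / ((n + 1 : ℕ) : ℝ≥0∞) ∂μ := by
    refine lintegral_congr_ae ?_
    filter_upwards [Φ.ae_isYoungFunction] with t ht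
    rw [ht.mul_bFun_eq_iSup enorm_ne_top]
    refine iSup_congr fun n => ?_
    rw [enorm_mul, Real.enorm_natCast]
  rw [h1, lintegral_iSup' (fun n => (Φ.aemeasurable_const_mul x _).div_const _)]
  · refine iSup_congr fun n => ?_
    simp only [modularReal, modular, div_eq_mul_inv]
    rw [lintegral_mul_const' _ _ (by simp), ENNReal.ofReal_natCast]
  · filter_upwards [Φ.ae_isYoungFunction] with t ht
    refine monotone_nat_of_le_succ fun n => ?_
    simp only [enorm_mul, Real.enorm_natCast]
    exact ht.div_le_div (by simp) (by gcongr; exact Nat.le_succ _) (ENNReal.natCast_ne_top _)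

/-- Left lower semicontinuity in k, from monotone convergence along a sequence increasing to k.
Since the modular is monotone in k, this is all that the next semicontinuity statement needs. -/
theorem modularReal_lt_liminf (x : T →ₘ[μ] ℝ) {k : ℝ} (hk : 0 < k) {c : ℝ≥0∞}
    (hc : c < modularReal μ Φ.toFun fun t => k * x t) :
    ∃ l, 0 < l ∧ l < k ∧ c < modularReal μ Φ.toFun fun t => l * x t := by
  obtain ⟨r, hr, hr0, hrk⟩ := exists_seq_strictMono_tendsto' hk
  have h1 : modularReal μ Φ.toFun (fun t => k * x t)
      = ⨆ n, modularReal μ Φ.toFun fun t => r n * x t := by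
    simp only [modularReal, modular]
    rw [← lintegral_iSup' (fun n => Φ.aemeasurable_const_mul x _)]
    · refine lintegral_congr_ae ?_
      filter_upwards [Φ.ae_isYoungFunction] with t ht
      have hle : ∀ n, ‖r n * x t‖ₑ ≤ ‖k * x t‖ₑ := fun n => by
        rw [enorm_mul, enorm_mul]
        gcongr
        rw [Real.enorm_of_nonneg (hr0 n).1.le, Real.enorm_of_nonneg hk.le]
        exact ENNReal.ofReal_le_ofReal (hr0 n).2.le
      refine le_antisymm ?_ (iSup_le fun n => ht.mono (hle n))
      refine le_of_forall_lt fun d hd => ?_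
      have hcont : Tendsto (fun n => ‖r n * x t‖ₑ) atTop (𝓝 ‖k * x t‖ₑ) :=
        (hrk.mul_const (x t)).enorm
      obtain ⟨n, hn⟩ := (hcont.eventually (ht.lowerSemicontinuous _ d hd)).exists
      exact hn.trans_le (le_iSup (fun n => Φ.toFun t ‖r n * x t‖ₑ) n)
    · filter_upwards [Φ.ae_isYoungFunction] with t ht
      intro m n hmn
      refine ht.mono ?_
      rw [enorm_mul, enorm_mul]
      gcongr
      rw [Real.enorm_of_nonneg (hr0 m).1.le, Real.enorm_of_nonneg (hr0 n).1.le]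
      exact ENNReal.ofReal_le_ofReal (hr.monotone hmn)
  rw [h1] at hc
  obtain ⟨n, hn⟩ := lt_iSup_iff.1 hc
  exact ⟨r n, (hr0 n).1, (hr0 n).2, hn⟩

theorem modularReal_mul_mono (x : T →ₘ[μ] ℝ) {k l : ℝ} (hk : 0 ≤ k) (hkl : k ≤ l) :
    modularReal μ Φ.toFun (fun t => k * x t) ≤ modularReal μ Φ.toFun fun t => l * x t := by
  refine Φ.modularReal_mono (ae_of_all _ fun t => ?_)
  rw [abs_mul, abs_mul, abs_of_nonneg hk, abs_of_nonneg (hk.trans hkl)]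
  gcongr

theorem lowerSemicontinuousOn_amemiya (x : T →ₘ[μ] ℝ) :
    LowerSemicontinuousOn (Φ.amemiya x) (Ioi 0) := by
  intro k hk c hc
  have hk : 0 < k := hk
  have hk0 : ENNReal.ofReal k ≠ 0 := by simpa using hk
  refine Eventually.filter_mono nhdsWithin_le_nhds ?_
  have hct : c ≠ ∞ := ne_top_of_lt hc
  rw [gt_iff_lt, amemiya,
    ENNReal.lt_div_iff_mul_lt (Or.inl hk0) (Or.inl ENNReal.ofReal_ne_top)] at hc
  have key : ∃ l, 0 < l ∧ l < k ∧
      c * ENNReal.ofReal k < 1 + modularReal μ Φ.toFun fun t => l * x t := by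
    -- Below 1 the summand 1 alone suffices, and any l in (0, k) will do.
    rcases lt_or_ge (c * ENNReal.ofReal k) 1 with h1 | h1
    · exact ⟨k / 2, half_pos hk, half_lt_self hk, h1.trans_le le_self_add⟩
    · obtain ⟨d, hd⟩ := exists_add_of_le h1
      rw [hd] at hc
      obtain ⟨l, h0, hl, h⟩ := Φ.modularReal_lt_liminf x hk (lt_of_add_lt_add_left hc)
      refine ⟨l, h0, hl, ?_⟩
      rw [hd]
      exact ENNReal.add_lt_add_left ENNReal.one_ne_top h
  obtain ⟨l, hl0, hlk, hl⟩ := key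
  have hcont : Tendsto (fun r : ℝ => c * ENNReal.ofReal r) (𝓝 k) (𝓝 (c * ENNReal.ofReal k)) :=
    ENNReal.Tendsto.const_mul (ENNReal.continuous_ofReal.tendsto k) (Or.inr hct)
  filter_upwards [hcont.eventually_lt_const hl, lt_mem_nhds hlk] with r hr hlr
  rw [gt_iff_lt, amemiya, ENNReal.lt_div_iff_mul_lt (Or.inl (by simpa using hl0.trans hlr))
    (Or.inl ENNReal.ofReal_ne_top)]
  refine hr.trans_le ?_
  gcongr
  exact Φ.modularReal_mul_mono x hl0.le (le_of_lt hlr)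

/-! ### Consequences of non-attainment of the Amemiya infimum. -/

theorem iInf_amemiya_lt_top {x : T →ₘ[μ] ℝ} (hx : x ∈ Φ.space) :
    ⨅ (l : ℝ) (_ : 0 < l), Φ.amemiya x l < ∞ := by
  obtain ⟨c, hc, hfin⟩ := hx
  refine (iInf₂_le c hc).trans_lt (ENNReal.div_lt_top ?_ (by simpa using hc))
  exact ENNReal.add_ne_top.2 ⟨ENNReal.one_ne_top, hfin.ne⟩

/-- On a compact interval in (0, ∞) the quotient attains its minimum, which must exceed the infimum
when `Φ.K x` is empty. Near-minimizers therefore avoid the interval, and small k are excluded by the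
lower bound 1/k. -/
theorem exists_amemiya_lt_of_K_eq_empty {x : T →ₘ[μ] ℝ} (hx : x ∈ Φ.space) (hK : Φ.K x = ∅)
    {c : ℝ≥0∞} (hc : ⨅ (l : ℝ) (_ : 0 < l), Φ.amemiya x l < c) (R : ℝ) :
    ∃ k, R < k ∧ 0 < k ∧ Φ.amemiya x k < c := by
  set m := ⨅ (l : ℝ) (_ : 0 < l), Φ.amemiya x l with hm
  have hmt : m ≠ ∞ := (Φ.iInf_amemiya_lt_top hx).ne
  set ε : ℝ := (m + 1).toReal⁻¹ with hε
  have hm1 : m + 1 ≠ ∞ := by simp [hmt]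
  have hpos : 0 < (m + 1).toReal := ENNReal.toReal_pos (by simp) hm1
  have hε0 : 0 < ε := inv_pos.2 hpos
  -- The left end is ε = 1/(m + 1): for l < ε the quotient is at least 1/l > m + 1.
  obtain ⟨k, hk, hmin⟩ := LowerSemicontinuousOn.exists_isMinOn (s := Icc ε (max R ε))
    ⟨ε, le_rfl, le_max_right _ _⟩ isCompact_Icc
    ((Φ.lowerSemicontinuousOn_amemiya x).mono fun y hy => hε0.trans_le hy.1)
  have hk0 : 0 < k := hε0.trans_le hk.1
  have hmk : m < Φ.amemiya x k := by
    refine lt_of_le_of_ne (iInf₂_le k hk0) fun h => ?_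
    have : k ∈ Φ.K x := ⟨hk0, h.symm⟩
    rw [hK] at this
    exact this
  have hlt : m < min (min c (m + 1)) (Φ.amemiya x k) :=
    lt_min (lt_min hc (ENNReal.lt_add_right hmt one_ne_zero)) hmk
  obtain ⟨l, hl⟩ := iInf_lt_iff.1 (hm ▸ hlt)
  obtain ⟨hl0, hl⟩ := iInf_lt_iff.1 hl
  have hl1 : Φ.amemiya x l < c := hl.trans_le ((min_le_left _ _).trans (min_le_left _ _))
  have hl2 : Φ.amemiya x l < m + 1 := hl.trans_le ((min_le_left _ _).trans (min_le_right _ _))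
  have hl3 : Φ.amemiya x l < Φ.amemiya x k := hl.trans_le (min_le_right _ _)
  refine ⟨l, ?_, hl0, hl1⟩
  by_contra hR
  have hlε : ε ≤ l := by
    have h1 : 1 < (m + 1) * ENNReal.ofReal l := by
      rw [amemiya, ENNReal.div_lt_iff (Or.inl (by simpa using hl0)) (Or.inl ENNReal.ofReal_ne_top)]
        at hl2
      exact le_self_add.trans_lt hl2
    have h2 : 1 < (m + 1).toReal * l := by
      have := (ENNReal.toReal_lt_toReal ENNReal.one_ne_top
        (ENNReal.mul_ne_top hm1 ENNReal.ofReal_ne_top)).2 h1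
      rwa [ENNReal.toReal_mul, ENNReal.toReal_ofReal hl0.le, ENNReal.toReal_one] at this
    rw [hε, inv_le_iff_one_le_mul₀' hpos]
    exact h2.le
  exact absurd (hmin ⟨hlε, (not_lt.1 hR).trans (le_max_left _ _)⟩) (not_le.2 hl3)

theorem modularReal_lt_top_of_K_eq_empty {x : T →ₘ[μ] ℝ} (hx : x ∈ Φ.space) (hK : Φ.K x = ∅)
    {k : ℝ} (hk : 0 ≤ k) : modularReal μ Φ.toFun (fun t => k * x t) < ∞ := by
  obtain ⟨l, hkl, hl0, hl⟩ :=
    Φ.exists_amemiya_lt_of_K_eq_empty hx hK (Φ.iInf_amemiya_lt_top hx) k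
  refine (Φ.modularReal_mul_mono x hk hkl.le).trans_lt ?_
  by_contra h
  rw [not_lt, top_le_iff] at h
  rw [amemiya, h, add_top, ENNReal.top_div_of_ne_top ENNReal.ofReal_ne_top] at hl
  exact lt_irrefl _ hl

/-- For each n a near-minimizer l > n + 1 exists, and I_Φ(kx)/k is nondecreasing in k, so its value
at n + 1 is bounded by its value at l and hence by the quotient there. -/
theorem lintegral_mul_bFun_le_iInf_amemiya {x : T →ₘ[μ] ℝ} (hx : x ∈ Φ.space) (hK : Φ.K x = ∅) :
    ∫⁻ t, ‖x t‖ₑ * bFun (complementary Φ.toFun) t ∂μ ≤ ⨅ (l : ℝ) (_ : 0 < l), Φ.amemiya x l := by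
  rw [lintegral_mul_bFun_eq_iSup]
  refine iSup_le fun n => le_of_forall_gt fun c hc => ?_
  obtain ⟨l, hnl, hl0, hl⟩ := Φ.exists_amemiya_lt_of_K_eq_empty hx hK hc ((n + 1 : ℕ) : ℝ)
  refine ((Φ.modularReal_div_mono x (by positivity) hnl.le).trans ?_).trans_lt hl
  rw [amemiya]
  gcongr
  exact le_add_self

theorem lintegral_mul_bFun_ne_top {x : T →ₘ[μ] ℝ} (hx : x ∈ Φ.space) (hK : Φ.K x = ∅) :
    ∫⁻ t, ‖x t‖ₑ * bFun (complementary Φ.toFun) t ∂μ ≠ ∞ :=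
  ((Φ.lintegral_mul_bFun_le_iInf_amemiya hx hK).trans_lt (Φ.iInf_amemiya_lt_top hx)).ne

theorem ae_bFun_ne_top {x : T →ₘ[μ] ℝ}
    (hx : ∫⁻ t, ‖x t‖ₑ * bFun (complementary Φ.toFun) t ∂μ ≠ ∞) :
    ∀ᵐ t ∂μ, t ∈ Function.support x → bFun (complementary Φ.toFun) t ≠ ∞ := by
  filter_upwards [ae_lt_top' (x.aestronglyMeasurable.enorm.mul Φ.aemeasurable_bFun) hx]
    with t ht hs hb
  rw [Pi.mul_apply, hb, ENNReal.mul_top (by simpa using hs)] at ht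
  exact lt_irrefl _ ht

/-- The modular of the complementary function at `b χ_{supp x}`, as a limit along `n x`. -/
theorem modular_indicator_bFun_le_iSup {x : T →ₘ[μ] ℝ}
    (hx : ∫⁻ t, ‖x t‖ₑ * bFun (complementary Φ.toFun) t ∂μ ≠ ∞) :
    modular μ (complementary Φ.toFun)
        ((Function.support x).indicator (bFun (complementary Φ.toFun)))
      ≤ ⨆ n : ℕ, (((n + 1 : ℕ) : ℝ≥0∞) * (∫⁻ t, ‖x t‖ₑ * bFun (complementary Φ.toFun) t ∂μ)
          - modularReal μ Φ.toFun fun t => ((n + 1 : ℕ) : ℝ) * x t) := by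
  have hle : ∀ n : ℕ, (fun t => Φ.toFun t ‖((n + 1 : ℕ) : ℝ) * x t‖ₑ)
      ≤ᵐ[μ] fun t => ((n + 1 : ℕ) : ℝ≥0∞) * ‖x t‖ₑ * bFun (complementary Φ.toFun) t := by
    intro n
    filter_upwards [Φ.ae_isYoungFunction] with t ht
    rw [enorm_mul, Real.enorm_natCast]
    exact ht.le_mul_bFun (ENNReal.mul_ne_top (ENNReal.natCast_ne_top _) enorm_ne_top)
  have hint : ∀ n : ℕ,
      ∫⁻ t, ((n + 1 : ℕ) : ℝ≥0∞) * ‖x t‖ₑ * bFun (complementary Φ.toFun) t ∂μ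
        = ((n + 1 : ℕ) : ℝ≥0∞) * (∫⁻ t, ‖x t‖ₑ * bFun (complementary Φ.toFun) t ∂μ) := by
    intro n
    simp only [mul_assoc]
    rw [lintegral_const_mul' _ _ (ENNReal.natCast_ne_top _)]
  have hsub : ∀ n : ℕ, ∫⁻ t, (((n + 1 : ℕ) : ℝ≥0∞) * ‖x t‖ₑ * bFun (complementary Φ.toFun) t
        - Φ.toFun t ‖((n + 1 : ℕ) : ℝ) * x t‖ₑ) ∂μ
      = ((n + 1 : ℕ) : ℝ≥0∞) * (∫⁻ t, ‖x t‖ₑ * bFun (complementary Φ.toFun) t ∂μ)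
          - modularReal μ Φ.toFun fun t => ((n + 1 : ℕ) : ℝ) * x t := by
    intro n
    rw [lintegral_sub' (Φ.aemeasurable_const_mul x _) _ (hle n), hint]
    · rfl
    · refine ((lintegral_mono_ae (hle n)).trans_lt ?_).ne
      rw [hint]
      exact (ENNReal.mul_ne_top (ENNReal.natCast_ne_top _) hx).lt_top
  simp only [← hsub]
  have hmeas : ∀ n : ℕ, AEMeasurable (fun t => ((n + 1 : ℕ) : ℝ≥0∞) * ‖x t‖ₑ
      * bFun (complementary Φ.toFun) t - Φ.toFun t ‖((n + 1 : ℕ) : ℝ) * x t‖ₑ) μ := fun n =>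
    ((x.aestronglyMeasurable.enorm.const_mul _).mul Φ.aemeasurable_bFun).sub
      (Φ.aemeasurable_const_mul x _)
  -- The integrands are nondecreasing in n, so monotone convergence reduces the claim to the
  -- pointwise bound.
  rw [← lintegral_iSup' hmeas]
  · refine lintegral_mono_ae ?_
    filter_upwards [Φ.ae_isYoungFunction, Φ.ae_bFun_ne_top hx] with t ht hb
    by_cases hs : t ∈ Function.support x
    · rw [indicator_of_mem hs]
      refine (ht.complementary_bFun_le_iSup (hb hs) (s := ‖x t‖ₑ) (by simpa using hs)
        enorm_ne_top).trans (le_of_eq ?_)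
      refine iSup_congr fun n => ?_
      rw [enorm_mul, Real.enorm_natCast]
    · rw [indicator_of_notMem hs, complementary_zero]
      exact zero_le
  · filter_upwards [Φ.ae_isYoungFunction, Φ.ae_bFun_ne_top hx] with t ht hb
    by_cases hs : t ∈ Function.support x
    · refine monotone_nat_of_le_succ fun n => ?_
      simp only [enorm_mul, Real.enorm_natCast]
      refine ht.mul_bFun_sub_mono (hb hs) ?_
        (ENNReal.mul_ne_top (ENNReal.natCast_ne_top _) enorm_ne_top)
      gcongr
      exact Nat.le_succ _
    · have : x t = 0 := by simpa using hs
      intro m n _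
      simp [this]

/-- Since ∫|x|b is at most every Amemiya quotient, n∫|x|b − I_Φ(nx) ≤ 1 for every n ≥ 1. This makes
b sgn x admissible in the Orlicz norm. -/
theorem modular_indicator_bFun_le_one {x : T →ₘ[μ] ℝ} (hx : x ∈ Φ.space) (hK : Φ.K x = ∅) :
    modular μ (complementary Φ.toFun)
        ((Function.support x).indicator (bFun (complementary Φ.toFun))) ≤ 1 := by
  refine (Φ.modular_indicator_bFun_le_iSup (Φ.lintegral_mul_bFun_ne_top hx hK)).trans
    (iSup_le fun n => ?_)
  rw [tsub_le_iff_right]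
  have hn : (0 : ℝ) < ((n + 1 : ℕ) : ℝ) := by positivity
  have h := (Φ.lintegral_mul_bFun_le_iInf_amemiya hx hK).trans (iInf₂_le _ hn)
  rw [amemiya, ENNReal.le_div_iff_mul_le (Or.inl (by simpa using hn))
    (Or.inl ENNReal.ofReal_ne_top), ENNReal.ofReal_natCast, mul_comm] at h
  exact h

end MusielakOrlicz

/-- From ‖x‖ + s f(y) = f(x + sy) ≤ ‖x + sy‖: a support functional lies below the one-sided
difference quotients of the norm. One suitable s for each ε is enough. -/
theorem IsSupportFunctional.apply_le_of_norm_add_smul_le {X : Type*} [NormedAddCommGroup X]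
    [NormedSpace ℝ X] {x : X} {f : X →L[ℝ] ℝ} (hf : IsSupportFunctional x f) {y : X} {c : ℝ}
    (h : ∀ ε : ℝ, 0 < ε → ∃ s : ℝ, 0 < s ∧ ‖x + s • y‖ ≤ ‖x‖ + s * (c + ε)) : f y ≤ c := by
  refine le_of_forall_pos_le_add fun ε hε => ?_
  obtain ⟨s, hs, hle⟩ := h ε hε
  have h1 : f (x + s • y) ≤ ‖x + s • y‖ := by
    have := f.le_opNorm (x + s • y)
    rw [hf.1, one_mul] at this
    exact (le_abs_self _).trans this
  rw [map_add, map_smul, hf.2, smul_eq_mul] at h1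
  exact le_of_mul_le_mul_left (by linarith) hs

theorem tendsto_abs_add_sub_abs {a b : ℝ} (ha : a ≠ 0) :
    Tendsto (fun n : ℕ => ((n + 1 : ℕ) : ℝ) * (|a + ((n + 1 : ℕ) : ℝ)⁻¹ * b| - |a|)) atTop
      (𝓝 (a / |a| * b)) := by
  have hlim : Tendsto (fun n : ℕ => a + ((n + 1 : ℕ) : ℝ)⁻¹ * b) atTop (𝓝 (a + 0 * b)) :=
    ((tendsto_inv_atTop_nhds_zero_nat.comp (tendsto_add_atTop_nat 1)).mul_const b).const_add a
  rw [zero_mul, add_zero] at hlim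
  -- For large n the perturbed number has the sign of a, so the sequence is eventually constant.
  refine tendsto_const_nhds.congr' ?_
  rcases lt_or_gt_of_ne ha with h | h
  · filter_upwards [hlim.eventually_lt_const h] with n hn
    have : ((n + 1 : ℕ) : ℝ) ≠ 0 := by positivity
    rw [abs_of_neg hn, abs_of_neg h]
    field_simp
    ring
  · filter_upwards [hlim.eventually_const_lt h] with n hn
    have : ((n + 1 : ℕ) : ℝ) ≠ 0 := by positivity
    rw [abs_of_pos hn, abs_of_pos h]
    field_simp
    ring

/-! ### Upper bounds for the Orlicz norm and the norming function b sgn x. -/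

namespace MusielakOrlicz

variable {T : Type*} [MeasurableSpace T] {μ : Measure T} (Φ : MusielakOrlicz μ)

theorem ofReal_orliczNorm_le {x : T →ₘ[μ] ℝ} {C : ℝ≥0∞}
    (h : ∀ v : T →ₘ[μ] ℝ, modularReal μ (complementary Φ.toFun) v ≤ 1 →
      ∫⁻ t, ‖x t * v t‖ₑ ∂μ ≤ C) : ENNReal.ofReal (Φ.orliczNorm x) ≤ C := by
  rcases eq_or_ne C ∞ with rfl | hC
  · exact le_top
  refine ENNReal.ofReal_le_of_le_toReal (csSup_le (Φ.orliczNorm_nonempty x) ?_)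
  rintro _ ⟨v, hv, rfl⟩
  have h3 := ENNReal.toReal_mono hC ((enorm_integral_le_lintegral_enorm (μ := μ)
    (fun t => x t * v t)).trans (h v hv))
  simpa using h3

/-- Only this easy half of the Amemiya formula is needed; equality for u is replaced by ‖u‖ = ∫|u|b.
-/
theorem ofReal_mul_orliczNorm_le (x : T →ₘ[μ] ℝ) {c : ℝ} (hc : 0 < c) :
    ENNReal.ofReal c * ENNReal.ofReal (Φ.orliczNorm x)
      ≤ 1 + modularReal μ Φ.toFun fun t => c * x t := by
  have hc0 : ENNReal.ofReal c ≠ 0 := by simpa using hc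
  rw [mul_comm, ← ENNReal.le_div_iff_mul_le (Or.inl hc0) (Or.inl ENNReal.ofReal_ne_top)]
  refine Φ.ofReal_orliczNorm_le fun v hv => ?_
  rw [ENNReal.le_div_iff_mul_le (Or.inl hc0) (Or.inl ENNReal.ofReal_ne_top), mul_comm]
  exact Φ.lintegral_mul_le x v hc hv

/-- A finite modular of v under Φ* forces |v| ≤ b almost everywhere. -/
theorem ofReal_orliczNorm_le_lintegral_mul_bFun (x : T →ₘ[μ] ℝ) :
    ENNReal.ofReal (Φ.orliczNorm x)
      ≤ ∫⁻ t, ‖x t‖ₑ * bFun (complementary Φ.toFun) t ∂μ := by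
  refine Φ.ofReal_orliczNorm_le fun v hv => lintegral_mono_ae ?_
  filter_upwards [ae_lt_top' (Φ.aemeasurable_complementary v.aestronglyMeasurable.enorm)
    (ne_top_of_le_ne_top ENNReal.one_ne_top hv)] with t ht
  rw [enorm_mul]
  gcongr
  exact le_bFun ht.ne

theorem integrable_mul {x : T →ₘ[μ] ℝ} (hx : x ∈ Φ.space) {v : T →ₘ[μ] ℝ}
    (hv : modularReal μ (complementary Φ.toFun) v ≤ 1) : Integrable (fun t => x t * v t) μ :=
  ((Φ.exists_bound hx).choose_spec v hv).1

theorem mem_space_of_abs_le {x y : T →ₘ[μ] ℝ} (hx : x ∈ Φ.space)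
    (h : ∀ᵐ t ∂μ, |y t| ≤ |x t|) : y ∈ Φ.space := by
  obtain ⟨c, hc, hfin⟩ := hx
  refine ⟨c, hc, (Φ.modularReal_mono ?_).trans_lt hfin⟩
  filter_upwards [h] with t ht
  rw [abs_mul, abs_mul]
  gcongr

section Functional

variable [SigmaFinite μ]

/-- The functional `x ↦ ∫ x v dμ` given by `v` with `I_{Φ*}(v) ≤ 1`. -/
noncomputable def pairing (v : T →ₘ[μ] ℝ) (hv : modularReal μ (complementary Φ.toFun) v ≤ 1) :
    Φ.space →L[ℝ] ℝ :=
  LinearMap.mkContinuous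
    { toFun := fun x => ∫ t, (x : T →ₘ[μ] ℝ) t * v t ∂μ
      map_add' := by
        intro x y
        rw [← integral_add (Φ.integrable_mul x.2 hv) (Φ.integrable_mul y.2 hv)]
        refine integral_congr_ae ?_
        filter_upwards [AEEqFun.coeFn_add (x : T →ₘ[μ] ℝ) y] with t ht
        rw [Submodule.coe_add, ht, Pi.add_apply, add_mul]
      map_smul' := by
        intro a x
        rw [RingHom.id_apply, smul_eq_mul, ← integral_const_mul]
        refine integral_congr_ae ?_
        filter_upwards [AEEqFun.coeFn_smul a (x : T →ₘ[μ] ℝ)] with t ht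
        rw [Submodule.coe_smul, ht, Pi.smul_apply, smul_eq_mul, mul_assoc] }
    1 (fun x => by
      rw [one_mul]
      exact le_csSup (Φ.orliczNorm_bddAbove x.2) ⟨v, hv, rfl⟩)

theorem pairing_apply (v : T →ₘ[μ] ℝ) (hv : modularReal μ (complementary Φ.toFun) v ≤ 1)
    (x : Φ.space) : Φ.pairing v hv x = ∫ t, (x : T →ₘ[μ] ℝ) t * v t ∂μ := rfl

theorem isSupportFunctional_pairing {v : T →ₘ[μ] ℝ}
    (hv : modularReal μ (complementary Φ.toFun) v ≤ 1) {x : Φ.space} (hx : x ≠ 0)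
    (h : Φ.pairing v hv x = ‖x‖) : IsSupportFunctional x (Φ.pairing v hv) := by
  refine ⟨le_antisymm (LinearMap.mkContinuous_norm_le _ zero_le_one _) ?_, h⟩
  have h1 := (Φ.pairing v hv).le_opNorm x
  rw [h, norm_norm] at h1
  exact le_of_mul_le_mul_right (by rwa [one_mul]) (norm_pos_iff.2 hx)

end Functional

/-- The function `b_{Φ*} sgn x`, which vanishes off the support of `x`. -/
noncomputable def signBFun (x : T →ₘ[μ] ℝ) : T →ₘ[μ] ℝ :=
  AEEqFun.mk (fun t => x t / |x t| * (bFun (complementary Φ.toFun) t).toReal)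
    (((x.aestronglyMeasurable.aemeasurable.div x.aestronglyMeasurable.aemeasurable.norm).mul
      Φ.aemeasurable_bFun.ennreal_toReal).aestronglyMeasurable)

theorem coeFn_signBFun (x : T →ₘ[μ] ℝ) :
    Φ.signBFun x =ᵐ[μ] fun t => x t / |x t| * (bFun (complementary Φ.toFun) t).toReal :=
  AEEqFun.coeFn_mk _ _

theorem signBFun_eq_zero (x : T →ₘ[μ] ℝ) : ∀ᵐ t ∂μ, x t = 0 → Φ.signBFun x t = 0 := by
  filter_upwards [Φ.coeFn_signBFun x] with t ht h0
  simp [ht, h0]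

/-- `toReal` sends ∞ to 0, but finiteness of ∫|x|b makes b finite on the support; off it, 0/0 = 0
removes b. -/
theorem enorm_signBFun {x : T →ₘ[μ] ℝ}
    (hx : ∫⁻ t, ‖x t‖ₑ * bFun (complementary Φ.toFun) t ∂μ ≠ ∞) :
    (fun t => ‖Φ.signBFun x t‖ₑ)
      =ᵐ[μ] (Function.support x).indicator (bFun (complementary Φ.toFun)) := by
  filter_upwards [Φ.coeFn_signBFun x, Φ.ae_bFun_ne_top hx] with t ht hb
  by_cases hs : t ∈ Function.support x
  · rw [indicator_of_mem hs, ht, enorm_mul]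
    have h1 : ‖x t / |x t|‖ₑ = 1 := by
      have : x t ≠ 0 := hs
      rw [← ofReal_norm, Real.norm_eq_abs, abs_div, abs_abs, div_self (abs_ne_zero.2 this),
        ENNReal.ofReal_one]
    rw [h1, one_mul, Real.enorm_of_nonneg ENNReal.toReal_nonneg, ENNReal.ofReal_toReal (hb hs)]
  · have : x t = 0 := by simpa using hs
    rw [indicator_of_notMem hs, ht, this]
    simp

theorem modularReal_signBFun {x : T →ₘ[μ] ℝ}
    (hx : ∫⁻ t, ‖x t‖ₑ * bFun (complementary Φ.toFun) t ∂μ ≠ ∞) :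
    modularReal μ (complementary Φ.toFun) (Φ.signBFun x)
      = modular μ (complementary Φ.toFun)
        ((Function.support x).indicator (bFun (complementary Φ.toFun))) := by
  refine lintegral_congr_ae ?_
  filter_upwards [Φ.enorm_signBFun hx] with t ht
  rw [ht]

theorem mul_signBFun (x : T →ₘ[μ] ℝ) :
    (fun t => x t * Φ.signBFun x t) =ᵐ[μ] fun t => |x t| * |Φ.signBFun x t| := by
  filter_upwards [Φ.coeFn_signBFun x] with t ht
  have h0 : 0 ≤ x t * Φ.signBFun x t := by
    rw [ht, ← mul_assoc, mul_div_assoc']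
    exact mul_nonneg (div_nonneg (mul_self_nonneg _) (abs_nonneg _)) ENNReal.toReal_nonneg
  rw [← abs_mul, abs_of_nonneg h0]

theorem orliczNorm_le_integral_abs_mul_abs_signBFun {x y : T →ₘ[μ] ℝ}
    (hx : ∫⁻ t, ‖x t‖ₑ * bFun (complementary Φ.toFun) t ∂μ ≠ ∞)
    (hv : modularReal μ (complementary Φ.toFun) (Φ.signBFun x) ≤ 1)
    (hy : y ∈ Φ.space) (hyx : ∀ᵐ t ∂μ, x t = 0 → y t = 0) :
    Φ.orliczNorm y ≤ ∫ t, |y t| * |Φ.signBFun x t| ∂μ := by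
  have h1 : ∫⁻ t, ‖y t‖ₑ * bFun (complementary Φ.toFun) t ∂μ
      = ENNReal.ofReal (∫ t, |y t| * |Φ.signBFun x t| ∂μ) := by
    have h2 := ofReal_integral_norm_eq_lintegral_enorm (Φ.integrable_mul hy hv)
    simp only [norm_mul, Real.norm_eq_abs] at h2
    rw [h2]
    refine lintegral_congr_ae ?_
    filter_upwards [Φ.enorm_signBFun hx, hyx] with t ht h0
    rw [enorm_mul, ht]
    by_cases hs : t ∈ Function.support x
    · rw [indicator_of_mem hs]
    · rw [h0 (by simpa using hs)]
      simp
  have h3 := Φ.ofReal_orliczNorm_le_lintegral_mul_bFun y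
  rw [h1] at h3
  exact (ENNReal.ofReal_le_ofReal_iff (integral_nonneg fun t => by positivity)).1 h3

theorem integral_mul_signBFun {x : T →ₘ[μ] ℝ} (hxs : x ∈ Φ.space)
    (hx : ∫⁻ t, ‖x t‖ₑ * bFun (complementary Φ.toFun) t ∂μ ≠ ∞)
    (hv : modularReal μ (complementary Φ.toFun) (Φ.signBFun x) ≤ 1) :
    ∫ t, x t * Φ.signBFun x t ∂μ = Φ.orliczNorm x := by
  refine le_antisymm ((le_abs_self _).trans
    (le_csSup (Φ.orliczNorm_bddAbove hxs) ⟨_, hv, rfl⟩)) ?_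
  rw [integral_congr_ae (Φ.mul_signBFun x)]
  exact Φ.orliczNorm_le_integral_abs_mul_abs_signBFun hx hv hxs (ae_of_all _ fun _ h => h)

theorem lintegral_mul_bFun_eq_orliczNorm {x : T →ₘ[μ] ℝ} (hxs : x ∈ Φ.space)
    (hx : ∫⁻ t, ‖x t‖ₑ * bFun (complementary Φ.toFun) t ∂μ ≠ ∞)
    (hv : modularReal μ (complementary Φ.toFun) (Φ.signBFun x) ≤ 1) :
    ∫⁻ t, ‖x t‖ₑ * bFun (complementary Φ.toFun) t ∂μ = ENNReal.ofReal (Φ.orliczNorm x) := by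
  rw [← Φ.integral_mul_signBFun hxs hx hv, integral_congr_ae (Φ.mul_signBFun x)]
  have h2 := ofReal_integral_norm_eq_lintegral_enorm (Φ.integrable_mul hxs hv)
  simp only [norm_mul, Real.norm_eq_abs] at h2
  rw [h2]
  refine lintegral_congr_ae ?_
  filter_upwards [Φ.enorm_signBFun hx] with t ht
  rw [enorm_mul, ht]
  by_cases hs : t ∈ Function.support x
  · rw [indicator_of_mem hs]
  · rw [show x t = 0 by simpa using hs]
    simp

/-- The slope at zero passes to the modular by dominated convergence: nΦ(t, c|x|/n) tends to zero
pointwise and is bounded by the integrable Φ(t, c|x|). -/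
theorem exists_modularReal_le_mul {x : T →ₘ[μ] ℝ} (hx : x ∈ Φ.space)
    (ha : ∀ᵐ t ∂μ, x t ≠ 0 → aFun (complementary Φ.toFun) t = 0) {ε : ℝ≥0∞} (hε : 0 < ε) :
    ∃ l : ℝ, 0 < l ∧ modularReal μ Φ.toFun (fun t => l * x t) ≤ ENNReal.ofReal l * ε := by
  obtain ⟨c, hc, hfin⟩ := hx
  have hlim : Tendsto (fun n : ℕ => ∫⁻ t, ((n + 1 : ℕ) : ℝ≥0∞)
      * Φ.toFun t (((n + 1 : ℕ) : ℝ≥0∞)⁻¹ * ‖c * x t‖ₑ) ∂μ) atTop (𝓝 (∫⁻ _, 0 ∂μ)) := by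
    refine tendsto_lintegral_of_dominated_convergence' (fun t => Φ.toFun t ‖c * x t‖ₑ)
      (fun n => ?_) (fun n => ?_) hfin.ne ?_
    · exact (Φ.aemeasurable
        ((x.aestronglyMeasurable.const_mul c).enorm.const_mul _)).const_mul _
    · filter_upwards [Φ.ae_isYoungFunction] with t ht
      have h0 : ((n + 1 : ℕ) : ℝ≥0∞) ≠ 0 := by simp
      have h1 : ((n + 1 : ℕ) : ℝ≥0∞) ≠ ∞ := ENNReal.natCast_ne_top _
      have := ht.div_le_div (x := ‖c * x t‖ₑ) (ENNReal.inv_ne_zero.2 h1)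
        (ENNReal.inv_le_one.2 (by exact_mod_cast Nat.le_add_left 1 n)) ENNReal.one_ne_top
      rwa [one_mul, div_one, div_eq_mul_inv, inv_inv, mul_comm] at this
    · filter_upwards [Φ.ae_isYoungFunction, ha] with t ht hat
      rcases eq_or_ne (x t) 0 with h0 | h0
      · simp [h0, ht.map_zero]
      · exact ht.tendsto_div_zero_of_aFun_eq_zero (hat h0) enorm_ne_top
  rw [lintegral_zero] at hlim
  have hcε : 0 < ENNReal.ofReal c * ε := ENNReal.mul_pos (by simpa using hc) hε.ne'
  obtain ⟨n, hn⟩ := (hlim.eventually_lt_const hcε).exists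
  have hn0 : (0 : ℝ) < ((n + 1 : ℕ) : ℝ) := by positivity
  refine ⟨((n + 1 : ℕ) : ℝ)⁻¹ * c, by positivity, ?_⟩
  rw [lintegral_const_mul' _ _ (ENNReal.natCast_ne_top _)] at hn
  rw [ENNReal.ofReal_mul (by positivity), ENNReal.ofReal_inv_of_pos hn0, ENNReal.ofReal_natCast]
  have h1 : modularReal μ Φ.toFun (fun t => ((n + 1 : ℕ) : ℝ)⁻¹ * c * x t)
      = ∫⁻ t, Φ.toFun t (((n + 1 : ℕ) : ℝ≥0∞)⁻¹ * ‖c * x t‖ₑ) ∂μ := by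
    simp only [modularReal, modular]
    refine lintegral_congr fun t => ?_
    rw [mul_assoc, enorm_mul, Real.enorm_of_nonneg (by positivity), ENNReal.ofReal_inv_of_pos hn0,
      ENNReal.ofReal_natCast]
  rw [h1, mul_assoc, ← ENNReal.div_eq_inv_mul,
    ENNReal.le_div_iff_mul_le (Or.inl (by simp)) (Or.inl (ENNReal.natCast_ne_top _)), mul_comm]
  exact hn.le

/-! ### Bounds for support functionals on and off the support of u. -/

variable [SigmaFinite μ]

/-- Along x carried by the support, ‖u + sx‖ is at most ∫|u + sx||v|, with equality at s = 0. The
difference quotients of this integral converge to ∫xv, dominated by |x||v|. -/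
theorem support_apply_le_of_support_subset {u : Φ.space} {f : Φ.space →L[ℝ] ℝ}
    (hf : IsSupportFunctional u f)
    (hu : ∫⁻ t, ‖(u : T →ₘ[μ] ℝ) t‖ₑ * bFun (complementary Φ.toFun) t ∂μ ≠ ∞)
    (hv : modularReal μ (complementary Φ.toFun) (Φ.signBFun u) ≤ 1) {x : Φ.space}
    (hx : ∀ᵐ t ∂μ, (u : T →ₘ[μ] ℝ) t = 0 → (x : T →ₘ[μ] ℝ) t = 0) :
    f x ≤ Φ.pairing _ hv x := by
  set v := Φ.signBFun (u : T →ₘ[μ] ℝ) with hvdef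
  have hint : ∀ y : Φ.space, Integrable (fun t => |(y : T →ₘ[μ] ℝ) t| * |v t|) μ := fun y => by
    simpa only [abs_mul] using (Φ.integrable_mul y.2 hv).abs
  have hcoe : ∀ s : ℝ, ((u + s • x : Φ.space) : T →ₘ[μ] ℝ)
      =ᵐ[μ] fun t => (u : T →ₘ[μ] ℝ) t + s * (x : T →ₘ[μ] ℝ) t := fun s => by
    filter_upwards [AEEqFun.coeFn_add (u : T →ₘ[μ] ℝ) (s • (x : T →ₘ[μ] ℝ)),
      AEEqFun.coeFn_smul s (x : T →ₘ[μ] ℝ)] with t h1 h2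
    rw [Submodule.coe_add, Submodule.coe_smul, h1, Pi.add_apply, h2, Pi.smul_apply, smul_eq_mul]
  have hlim : Tendsto (fun n : ℕ => ∫ t, ((n + 1 : ℕ) : ℝ)
      * (|(u : T →ₘ[μ] ℝ) t + ((n + 1 : ℕ) : ℝ)⁻¹ * (x : T →ₘ[μ] ℝ) t| - |(u : T →ₘ[μ] ℝ) t|)
        * |v t| ∂μ) atTop (𝓝 (∫ t, (x : T →ₘ[μ] ℝ) t * v t ∂μ)) := by
    refine tendsto_integral_of_dominated_convergence
      (fun t => |(x : T →ₘ[μ] ℝ) t| * |v t|) (fun n => ?_) (hint x) (fun n => ?_) ?_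
    · have hum := (u : T →ₘ[μ] ℝ).aestronglyMeasurable
      have hxm := (x : T →ₘ[μ] ℝ).aestronglyMeasurable
      exact (((hum.add (hxm.const_mul _)).norm.sub hum.norm).const_mul _).mul
        v.aestronglyMeasurable.norm
    · refine ae_of_all _ fun t => ?_
      have hn : (0 : ℝ) < ((n + 1 : ℕ) : ℝ) := by positivity
      rw [Real.norm_eq_abs, abs_mul, abs_mul, abs_abs, abs_of_pos hn]
      gcongr
      have := abs_abs_sub_abs_le
        ((u : T →ₘ[μ] ℝ) t + ((n + 1 : ℕ) : ℝ)⁻¹ * (x : T →ₘ[μ] ℝ) t) ((u : T →ₘ[μ] ℝ) t)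
      rw [add_sub_cancel_left, abs_mul, abs_of_pos (inv_pos.2 hn)] at this
      calc _ ≤ ((n + 1 : ℕ) : ℝ) * (((n + 1 : ℕ) : ℝ)⁻¹ * |(x : T →ₘ[μ] ℝ) t|) := by gcongr
        _ = _ := by rw [mul_inv_cancel_left₀ hn.ne']
    · filter_upwards [Φ.coeFn_signBFun (u : T →ₘ[μ] ℝ), Φ.signBFun_eq_zero (u : T →ₘ[μ] ℝ)]
        with t ht h0
      rcases eq_or_ne ((u : T →ₘ[μ] ℝ) t) 0 with hut | hut
      · simp [hvdef, h0 hut]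
      · have h1 := (tendsto_abs_add_sub_abs (b := (x : T →ₘ[μ] ℝ) t) hut).mul_const |v t|
        convert h1 using 2
        have h2 : |v t| = (bFun (complementary Φ.toFun) t).toReal := by
          rw [hvdef, ht, abs_mul, abs_div, abs_abs, div_self (abs_ne_zero.2 hut), one_mul,
            abs_of_nonneg ENNReal.toReal_nonneg]
        rw [h2, hvdef, ht]
        ring
  refine hf.apply_le_of_norm_add_smul_le fun ε hε => ?_
  obtain ⟨n, hn⟩ := (hlim.eventually_lt_const (lt_add_of_pos_right _ hε)).exists
  have hn0 : (0 : ℝ) < ((n + 1 : ℕ) : ℝ) := by positivity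
  refine ⟨((n + 1 : ℕ) : ℝ)⁻¹, inv_pos.2 hn0, ?_⟩
  set s : ℝ := ((n + 1 : ℕ) : ℝ)⁻¹ with hs
  have h1 : ‖u + s • x‖ ≤ ∫ t, |((u + s • x : Φ.space) : T →ₘ[μ] ℝ) t| * |v t| ∂μ := by
    refine Φ.orliczNorm_le_integral_abs_mul_abs_signBFun hu hv (u + s • x).2 ?_
    filter_upwards [hcoe s, hx] with t ht h0 hut
    rw [ht, hut, h0 hut, mul_zero, add_zero]
  have h2 : ‖u‖ = ∫ t, |(u : T →ₘ[μ] ℝ) t| * |v t| ∂μ := by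
    rw [norm_def, ← Φ.integral_mul_signBFun u.2 hu hv]
    exact integral_congr_ae (Φ.mul_signBFun _)
  have h3 : ∫ t, ((n + 1 : ℕ) : ℝ)
      * (|(u : T →ₘ[μ] ℝ) t + s * (x : T →ₘ[μ] ℝ) t| - |(u : T →ₘ[μ] ℝ) t|) * |v t| ∂μ
      = ((n + 1 : ℕ) : ℝ) * ((∫ t, |((u + s • x : Φ.space) : T →ₘ[μ] ℝ) t| * |v t| ∂μ)
          - ∫ t, |(u : T →ₘ[μ] ℝ) t| * |v t| ∂μ) := by
    rw [← integral_sub (hint _) (hint _), ← integral_const_mul]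
    refine integral_congr_ae ?_
    filter_upwards [hcoe s] with t ht
    rw [ht]
    ring
  rw [h3, ← h2] at hn
  rw [pairing_apply]
  have h4 : (∫ t, |((u + s • x : Φ.space) : T →ₘ[μ] ℝ) t| * |v t| ∂μ) - ‖u‖
      ≤ s * ((∫ t, (x : T →ₘ[μ] ℝ) t * v t ∂μ) + ε) := by
    rw [hs, ← div_eq_inv_mul, le_div_iff₀' hn0]
    exact hn.le
  linarith

/-- The supports being disjoint, k‖u + (l/k)x‖ ≤ 1 + I_Φ(ku) + I_Φ(lx). Modular exactly 1 brings 1 +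
I_Φ(ku) within lε/2 of k‖u‖, and the zero slope of Φ gives I_Φ(lx) ≤ lε/2. -/
theorem support_apply_nonpos_of_disjoint_support {u : Φ.space} {f : Φ.space →L[ℝ] ℝ}
    (hf : IsSupportFunctional u f) (hK : Φ.K (u : T →ₘ[μ] ℝ) = ∅)
    (h1 : modular μ (complementary Φ.toFun) ((Function.support (u : T →ₘ[μ] ℝ)).indicator
      (bFun (complementary Φ.toFun))) = 1) {x : Φ.space}
    (hxu : ∀ᵐ t ∂μ, (u : T →ₘ[μ] ℝ) t ≠ 0 → (x : T →ₘ[μ] ℝ) t = 0)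
    (ha : ∀ᵐ t ∂μ, (x : T →ₘ[μ] ℝ) t ≠ 0 → aFun (complementary Φ.toFun) t = 0) :
    f x ≤ 0 := by
  have hu := Φ.lintegral_mul_bFun_ne_top u.2 hK
  have hv := (Φ.modularReal_signBFun hu).trans_le (Φ.modular_indicator_bFun_le_one u.2 hK)
  refine hf.apply_le_of_norm_add_smul_le fun ε hε => ?_
  obtain ⟨l, hl, hlx⟩ := Φ.exists_modularReal_le_mul x.2 ha
    (ε := ENNReal.ofReal (ε / 2)) (by simpa using hε)
  set δ := ENNReal.ofReal l * ENNReal.ofReal (ε / 2) with hδ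
  have hδ0 : δ ≠ 0 := mul_ne_zero (by simpa using hl) (by simpa using hε)
  -- The supremum of n∫|u|b − I_Φ(nu) is at least 1, so some n brings it above 1 − δ. The scale l,
  -- and with it δ, is fixed before n.
  have hsup := h1 ▸ Φ.modular_indicator_bFun_le_iSup hu
  obtain ⟨n, hn⟩ := lt_iSup_iff.1
    ((ENNReal.sub_lt_self ENNReal.one_ne_top one_ne_zero hδ0).trans_le hsup)
  rw [Φ.lintegral_mul_bFun_eq_orliczNorm u.2 hu hv, ← norm_def] at hn
  set k : ℝ := ((n + 1 : ℕ) : ℝ) with hk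
  have hk0 : 0 < k := by positivity
  have hkn : ((n + 1 : ℕ) : ℝ≥0∞) = ENNReal.ofReal k := by rw [hk, ENNReal.ofReal_natCast]
  rw [hkn] at hn
  have hfin := Φ.modularReal_lt_top_of_K_eq_empty u.2 hK hk0.le
  have hbound : 1 + modularReal μ Φ.toFun (fun t => k * (u : T →ₘ[μ] ℝ) t)
      ≤ ENNReal.ofReal k * ENNReal.ofReal ‖u‖ + δ := by
    have h2 := tsub_le_iff_right.1 hn.le
    have h3 : modularReal μ Φ.toFun (fun t => k * (u : T →ₘ[μ] ℝ) t)
        ≤ ENNReal.ofReal k * ENNReal.ofReal ‖u‖ := by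
      rw [norm_def, ← Φ.lintegral_mul_bFun_eq_orliczNorm u.2 hu hv, lintegral_mul_bFun_eq_iSup,
        mul_comm, ← ENNReal.div_le_iff (by simpa using hk0) ENNReal.ofReal_ne_top]
      exact le_iSup (fun n : ℕ => modularReal μ Φ.toFun
        (fun t => ((n + 1 : ℕ) : ℝ) * (u : T →ₘ[μ] ℝ) t) / ENNReal.ofReal ((n + 1 : ℕ) : ℝ)) n
    calc _ ≤ (ENNReal.ofReal k * ENNReal.ofReal ‖u‖
          - modularReal μ Φ.toFun (fun t => k * (u : T →ₘ[μ] ℝ) t) + δ)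
          + modularReal μ Φ.toFun (fun t => k * (u : T →ₘ[μ] ℝ) t) := by gcongr
      _ = (ENNReal.ofReal k * ENNReal.ofReal ‖u‖
          - modularReal μ Φ.toFun (fun t => k * (u : T →ₘ[μ] ℝ) t)
          + modularReal μ Φ.toFun (fun t => k * (u : T →ₘ[μ] ℝ) t)) + δ := by ring
      _ = _ := by rw [tsub_add_cancel_of_le h3]
  -- Scaling by k turns this step into exactly lx.
  refine ⟨l / k, by positivity, ?_⟩
  have hsplit : modularReal μ Φ.toFun
      (fun t => k * ((u + (l / k) • x : Φ.space) : T →ₘ[μ] ℝ) t)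
      ≤ modularReal μ Φ.toFun (fun t => k * (u : T →ₘ[μ] ℝ) t)
        + modularReal μ Φ.toFun (fun t => l * (x : T →ₘ[μ] ℝ) t) := by
    simp only [modularReal, modular]
    rw [← lintegral_add_left' (Φ.aemeasurable_const_mul _ _)]
    refine lintegral_mono_ae ?_
    filter_upwards [AEEqFun.coeFn_add (u : T →ₘ[μ] ℝ) ((l / k) • (x : T →ₘ[μ] ℝ)),
      AEEqFun.coeFn_smul (l / k) (x : T →ₘ[μ] ℝ), hxu] with t h2 h3 h4
    rw [Submodule.coe_add, Submodule.coe_smul, h2, Pi.add_apply, h3, Pi.smul_apply, smul_eq_mul]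
    rcases eq_or_ne ((u : T →ₘ[μ] ℝ) t) 0 with h0 | h0
    · rw [h0, zero_add, ← mul_assoc, mul_div_cancel₀ _ hk0.ne']
      exact le_add_self
    · rw [h4 h0, mul_zero, add_zero]
      exact le_self_add
  have h5 := Φ.ofReal_mul_orliczNorm_le ((u + (l / k) • x : Φ.space) : T →ₘ[μ] ℝ) hk0
  rw [← norm_def] at h5
  have h6 : ENNReal.ofReal (k * ‖u + (l / k) • x‖) ≤ ENNReal.ofReal (k * ‖u‖ + l * ε) := by
    rw [ENNReal.ofReal_mul hk0.le]
    refine (h5.trans (add_le_add_right hsplit 1)).trans ?_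
    rw [← add_assoc]
    refine (add_le_add hbound hlx).trans (le_of_eq ?_)
    rw [add_assoc, hδ, ← ENNReal.ofReal_mul hk0.le, ← ENNReal.ofReal_mul hl.le,
      ← ENNReal.ofReal_add (by positivity) (by positivity),
      ← ENNReal.ofReal_add (by positivity) (by positivity)]
    congr 1
    ring
  have h7 := (ENNReal.ofReal_le_ofReal_iff (by positivity)).1 h6
  refine le_of_mul_le_mul_left (h7.trans (le_of_eq ?_)) hk0
  field_simp
  ring

end MusielakOrlicz

/-! ### Second support functionals, and the reduction of uniqueness to directions off the support.
-/

namespace MusielakOrlicz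

variable {T : Type*} [MeasurableSpace T] {μ : Measure T}

theorem measurableSet_support (x : T →ₘ[μ] ℝ) : MeasurableSet (Function.support x) :=
  x.stronglyMeasurable.measurable (measurableSet_singleton 0).compl

variable [SigmaFinite μ] (Φ : MusielakOrlicz μ)

/-- Supplies test elements that separate functionals differing on B. As Φ(t, ·) tends to 0 at 0+,
the sets where Φ(t, 1/(n + 1)) ≤ 1 exhaust T up to a null set; on a piece of finite measure, χ_C/(n
+ 1) has modular at most μ(C). -/
theorem exists_indicator_mem_space {B : Set T} (hB : NullMeasurableSet B μ) (hB0 : μ B ≠ 0) :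
    ∃ x : Φ.space, ∃ C : Set T, C ⊆ B ∧ NullMeasurableSet C μ ∧ μ C ≠ 0 ∧ μ C ≠ ∞ ∧
      (x : T →ₘ[μ] ℝ) =ᵐ[μ] C.indicator fun _ => 1 := by
  set D : ℕ → ℕ → Set T := fun n m =>
    B ∩ ({t | Φ.toFun t (((n + 1 : ℕ) : ℝ≥0∞)⁻¹) ≤ 1} ∩ spanningSets μ m) with hD
  obtain ⟨n, m, hnm⟩ : ∃ n m, μ (D n m) ≠ 0 := by
    by_contra! hcon
    refine hB0 (measure_eq_zero_iff_ae_notMem.2 ?_)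
    have hall : ∀ᵐ t ∂μ, ∀ n m, t ∉ D n m :=
      ae_all_iff.2 fun n => ae_all_iff.2 fun m => measure_eq_zero_iff_ae_notMem.1 (hcon n m)
    filter_upwards [hall, Φ.ae_isYoungFunction] with t ht hY htB
    have hlim : Tendsto (fun n : ℕ => ((n + 1 : ℕ) : ℝ≥0∞)⁻¹) atTop (𝓝[>] 0) :=
      tendsto_nhdsWithin_iff.2
        ⟨ENNReal.tendsto_inv_nat_nhds_zero.comp (tendsto_add_atTop_nat 1),
          Eventually.of_forall fun n =>
            pos_iff_ne_zero.2 (ENNReal.inv_ne_zero.2 (ENNReal.natCast_ne_top _))⟩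
    obtain ⟨n, hn⟩ := ((hY.tendsto_zero.comp hlim).eventually_lt_const one_pos).exists
    obtain ⟨m, hm⟩ : ∃ m, t ∈ spanningSets μ m := by
      have := mem_univ t
      rwa [← iUnion_spanningSets μ, mem_iUnion] at this
    exact ht n m ⟨htB, le_of_lt hn, hm⟩
  have hDm : NullMeasurableSet (D n m) μ := hB.inter
    ((measurableSet_le (Φ.measurable _) measurable_const).inter
      (measurableSet_spanningSets μ m)).nullMeasurableSet
  have hDt : μ (D n m) < ∞ :=
    (measure_mono (inter_subset_right.trans inter_subset_right)).trans_lt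
      (measure_spanningSets_lt_top μ m)
  set y : T →ₘ[μ] ℝ := AEEqFun.mk ((D n m).indicator fun _ => 1)
    (aestronglyMeasurable_const.indicator₀ hDm) with hy
  have hye : y =ᵐ[μ] (D n m).indicator fun _ => 1 := AEEqFun.coeFn_mk _ _
  refine ⟨⟨y, ((n + 1 : ℕ) : ℝ)⁻¹, by positivity, ?_⟩, D n m, inter_subset_left, hDm, hnm,
    hDt.ne, hye⟩
  refine lt_of_le_of_lt ?_ hDt
  rw [← lintegral_indicator_one₀ hDm]
  refine lintegral_mono_ae ?_
  filter_upwards [hye, Φ.ae_isYoungFunction] with t ht hY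
  rw [ht]
  by_cases htD : t ∈ D n m
  · rw [indicator_of_mem htD, indicator_of_mem htD, mul_one, Real.enorm_of_nonneg (by positivity),
      ENNReal.ofReal_inv_of_pos (by positivity), ENNReal.ofReal_natCast]
    exact htD.2.1
  · simp [indicator_of_notMem htD, hY.map_zero]

/-- Both v and v + cχ_B are admissible and pair with u to ‖u‖, because u vanishes on B. An indicator
inside B distinguishes the two functionals. -/
theorem not_isSmoothPoint_of_setLIntegral_le {u : Φ.space} (hu0 : u ≠ 0)
    (hu : ∫⁻ t, ‖(u : T →ₘ[μ] ℝ) t‖ₑ * bFun (complementary Φ.toFun) t ∂μ ≠ ∞) {B : Set T}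
    (hB : NullMeasurableSet B μ) (hB0 : μ B ≠ 0)
    (hBu : ∀ t ∈ B, (u : T →ₘ[μ] ℝ) t = 0) {c : ℝ} (hc : 0 < c)
    (hle : modular μ (complementary Φ.toFun) ((Function.support (u : T →ₘ[μ] ℝ)).indicator
        (bFun (complementary Φ.toFun)))
      + ∫⁻ t in B, complementary Φ.toFun t (ENNReal.ofReal c) ∂μ ≤ 1) : ¬ IsSmoothPoint u := by
  set v := Φ.signBFun (u : T →ₘ[μ] ℝ) with hvdef
  have hv : modularReal μ (complementary Φ.toFun) v ≤ 1 :=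
    (Φ.modularReal_signBFun hu).trans_le (le_self_add.trans hle)
  set w : T →ₘ[μ] ℝ := AEEqFun.mk (B.indicator fun _ => c)
    (aestronglyMeasurable_const.indicator₀ hB) with hw
  have hwe : w =ᵐ[μ] B.indicator fun _ => c := AEEqFun.coeFn_mk _ _
  have hvw : modularReal μ (complementary Φ.toFun) (v + w : T →ₘ[μ] ℝ) ≤ 1 := by
    refine le_trans ?_ hle
    rw [← Φ.modularReal_signBFun hu, ← lintegral_indicator₀ hB]
    simp only [modularReal, modular]
    rw [← lintegral_add_left' (Φ.aemeasurable_complementary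
      (Φ.signBFun (u : T →ₘ[μ] ℝ)).aestronglyMeasurable.enorm)]
    refine lintegral_mono_ae ?_
    filter_upwards [AEEqFun.coeFn_add v w, hwe, Φ.signBFun_eq_zero (u : T →ₘ[μ] ℝ)] with t h1 h2 h3
    rw [h1, Pi.add_apply, h2]
    by_cases htB : t ∈ B
    · rw [indicator_of_mem htB, indicator_of_mem htB, hvdef, h3 (hBu t htB), zero_add,
        Real.enorm_of_nonneg hc.le]
      exact le_add_self
    · rw [indicator_of_notMem htB, add_zero]
      exact le_self_add
  have hmul : ∀ x : T →ₘ[μ] ℝ, (∀ᵐ t ∂μ, t ∈ B → x t = 0) →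
      ∫ t, x t * (v + w : T →ₘ[μ] ℝ) t ∂μ = ∫ t, x t * v t ∂μ := by
    intro x hx
    refine integral_congr_ae ?_
    filter_upwards [AEEqFun.coeFn_add v w, hwe, hx] with t h1 h2 h3
    by_cases htB : t ∈ B
    · simp [h3 htB]
    · rw [h1, Pi.add_apply, h2, indicator_of_notMem htB, add_zero]
  have hnorm : Φ.pairing v hv u = ‖u‖ := Φ.integral_mul_signBFun u.2 hu hv
  have hnorm' : Φ.pairing _ hvw u = ‖u‖ := by
    rw [← hnorm]
    exact hmul _ (ae_of_all _ hBu)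
  rintro ⟨-, f, -, huniq⟩
  have heq : Φ.pairing _ hvw = Φ.pairing v hv :=
    (huniq _ (Φ.isSupportFunctional_pairing hvw hu0 hnorm')).trans
      (huniq _ (Φ.isSupportFunctional_pairing hv hu0 hnorm)).symm
  obtain ⟨x, C, hCB, hCm, hC0, hCt, hxC⟩ := Φ.exists_indicator_mem_space hB hB0
  have h1 : Φ.pairing v hv x = 0 := by
    rw [pairing_apply, ← integral_zero T ℝ (μ := μ)]
    refine integral_congr_ae ?_
    filter_upwards [hxC, Φ.signBFun_eq_zero (u : T →ₘ[μ] ℝ)] with t h2 h3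
    rw [h2]
    by_cases htC : t ∈ C
    · rw [hvdef, h3 (hBu t (hCB htC)), mul_zero]
    · rw [indicator_of_notMem htC, zero_mul]
  have h2 : Φ.pairing _ hvw x = μ.real C * c := by
    rw [pairing_apply, ← smul_eq_mul, ← setIntegral_const, ← integral_indicator₀ hCm]
    refine integral_congr_ae ?_
    filter_upwards [hxC, hwe, AEEqFun.coeFn_add v w, Φ.signBFun_eq_zero (u : T →ₘ[μ] ℝ)]
      with t h3 h4 h5 h6
    rw [h3]
    by_cases htC : t ∈ C
    · rw [indicator_of_mem htC, indicator_of_mem htC, h5, Pi.add_apply, h4,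
        indicator_of_mem (hCB htC), hvdef, h6 (hBu t (hCB htC)), zero_add, one_mul]
    · rw [indicator_of_notMem htC, indicator_of_notMem htC, zero_mul]
  rw [heq, h1] at h2
  exact (mul_pos (ENNReal.toReal_pos hC0 hCt) hc).ne h2

theorem not_isSmoothPoint_of_lt_one {u : Φ.space} (hu0 : u ≠ 0)
    (hu : ∫⁻ t, ‖(u : T →ₘ[μ] ℝ) t‖ₑ * bFun (complementary Φ.toFun) t ∂μ ≠ ∞)
    (hlt : modular μ (complementary Φ.toFun) ((Function.support (u : T →ₘ[μ] ℝ)).indicator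
      (bFun (complementary Φ.toFun))) < 1)
    (hS : μ (Function.support (u : T →ₘ[μ] ℝ))ᶜ ≠ 0) : ¬ IsSmoothPoint u := by
  set α := modular μ (complementary Φ.toFun) ((Function.support (u : T →ₘ[μ] ℝ)).indicator
      (bFun (complementary Φ.toFun))) with hα
  set S := Function.support (u : T →ₘ[μ] ℝ) with hSdef
  set D : ℕ → ℕ → Set T := fun n m =>
    Sᶜ ∩ ({t | 1 ≤ Φ.toFun t ((n + 1 : ℕ) : ℝ≥0∞)} ∩ spanningSets μ m) with hD
  obtain ⟨n, m, hnm⟩ : ∃ n m, μ (D n m) ≠ 0 := by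
    by_contra! hcon
    refine hS (measure_eq_zero_iff_ae_notMem.2 ?_)
    have hall : ∀ᵐ t ∂μ, ∀ n m, t ∉ D n m :=
      ae_all_iff.2 fun n => ae_all_iff.2 fun m => measure_eq_zero_iff_ae_notMem.1 (hcon n m)
    filter_upwards [hall, Φ.ae_isYoungFunction] with t ht hY htB
    obtain ⟨n, hn⟩ := hY.exists_one_le
    obtain ⟨m, hm⟩ : ∃ m, t ∈ spanningSets μ m := by
      have := mem_univ t
      rwa [← iUnion_spanningSets μ, mem_iUnion] at this
    exact ht n m ⟨htB, hn, hm⟩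
  have hDm : MeasurableSet (D n m) := (measurableSet_support _).compl.inter
    ((measurableSet_le measurable_const (Φ.measurable _)).inter (measurableSet_spanningSets μ m))
  have hDt : μ (D n m) < ∞ :=
    (measure_mono (inter_subset_right.trans inter_subset_right)).trans_lt
      (measure_spanningSets_lt_top μ m)
  -- On `D n m` the complementary function at 1/((n + 1)(k + 1)) is at most 1/(k + 1); this k makes
  -- its integral fit into the slack 1 − α.
  obtain ⟨k, hk⟩ := ENNReal.exists_nat_gt
    (ENNReal.div_ne_top hDt.ne (tsub_pos_of_lt hlt).ne')
  refine Φ.not_isSmoothPoint_of_setLIntegral_le hu0 hu hDm.nullMeasurableSet hnm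
    (fun t ht => by simpa [hSdef] using ht.1) (c := ((n + 1 : ℕ) : ℝ)⁻¹ * ((k + 1 : ℕ) : ℝ)⁻¹)
    (by positivity) ?_
  have hce : ENNReal.ofReal (((n + 1 : ℕ) : ℝ)⁻¹ * ((k + 1 : ℕ) : ℝ)⁻¹)
      = ((n + 1 : ℕ) : ℝ≥0∞)⁻¹ * ((k + 1 : ℕ) : ℝ≥0∞)⁻¹ := by
    rw [ENNReal.ofReal_mul (by positivity), ENNReal.ofReal_inv_of_pos (by positivity),
      ENNReal.ofReal_inv_of_pos (by positivity), ENNReal.ofReal_natCast, ENNReal.ofReal_natCast]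
  have h1 : ∫⁻ t in D n m, complementary Φ.toFun t
      (ENNReal.ofReal (((n + 1 : ℕ) : ℝ)⁻¹ * ((k + 1 : ℕ) : ℝ)⁻¹)) ∂μ ≤ 1 - α := by
    calc _ ≤ ∫⁻ _ in D n m, ((k + 1 : ℕ) : ℝ≥0∞)⁻¹ ∂μ := by
          refine setLIntegral_mono_ae' hDm ?_
          filter_upwards [Φ.ae_isYoungFunction] with t hY ht
          rw [hce]
          exact complementary_le_of_one_le hY ht.2.1
      _ = ((k + 1 : ℕ) : ℝ≥0∞)⁻¹ * μ (D n m) := setLIntegral_const _ _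
      _ ≤ 1 - α := by
          rw [mul_comm, ← div_eq_mul_inv]
          refine ENNReal.div_le_of_le_mul ?_
          rw [ENNReal.div_lt_iff (Or.inl (tsub_pos_of_lt hlt).ne') (Or.inr hDt.ne), mul_comm] at hk
          refine hk.le.trans ?_
          gcongr
          exact Nat.le_succ k
  calc _ ≤ α + (1 - α) := by gcongr
    _ = 1 := add_tsub_cancel_of_le hlt.le

/-- Where `aFun` is positive, Φ* vanishes at some positive rational. Countability fixes one rational
q on a non-null set off the support, and adding q there leaves the modular unchanged. -/
theorem not_isSmoothPoint_of_aFun_ne_zero {u : Φ.space} (hu0 : u ≠ 0)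
    (hu : ∫⁻ t, ‖(u : T →ₘ[μ] ℝ) t‖ₑ * bFun (complementary Φ.toFun) t ∂μ ≠ ∞)
    (hle : modular μ (complementary Φ.toFun) ((Function.support (u : T →ₘ[μ] ℝ)).indicator
      (bFun (complementary Φ.toFun))) ≤ 1)
    (ha : ¬ ∀ᵐ t ∂μ, t ∉ Function.support (u : T →ₘ[μ] ℝ) →
      aFun (complementary Φ.toFun) t = 0) : ¬ IsSmoothPoint u := by
  set S := Function.support (u : T →ₘ[μ] ℝ) with hSdef
  set D : ℚ≥0 → Set T := fun q => Sᶜ ∩ {t | complementary Φ.toFun t ((q : ℝ≥0) : ℝ≥0∞) = 0} with hD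
  obtain ⟨q, hq0, hq⟩ : ∃ q : ℚ≥0, 0 < q ∧ μ (D q) ≠ 0 := by
    by_contra! hcon
    refine ha ?_
    have hall : ∀ᵐ t ∂μ, ∀ q : ℚ≥0, 0 < q → t ∉ D q :=
      ae_all_iff.2 fun q => by
        by_cases hq : 0 < q
        · simpa [hq] using measure_eq_zero_iff_ae_notMem.1 (hcon q hq)
        · simp [hq]
    filter_upwards [hall] with t ht htS
    refine le_zero_iff.1 (sSup_le fun v hv => ?_)
    by_contra hv0
    obtain ⟨q, hq0, hqv⟩ := ENNReal.exists_nnrat_btwn (not_le.1 hv0)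
    refine ht q (by simpa using hq0) ⟨htS, ?_⟩
    exact le_zero_iff.1 ((complementary_mono Φ.toFun t hqv.le).trans (le_of_eq hv))
  have hDm : NullMeasurableSet (D q) μ := (measurableSet_support _).compl.nullMeasurableSet.inter
    ((Φ.aemeasurable_complementary aemeasurable_const).nullMeasurable (measurableSet_singleton 0))
  refine Φ.not_isSmoothPoint_of_setLIntegral_le hu0 hu hDm hq
    (fun t ht => by simpa [hSdef] using ht.1) (c := ((q : ℝ≥0) : ℝ)) (by positivity) ?_
  have h1 : ∫⁻ t in D q, complementary Φ.toFun t (ENNReal.ofReal ((q : ℝ≥0) : ℝ)) ∂μ = 0 := by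
    rw [← lintegral_indicator₀ hDm, ← lintegral_zero (μ := μ)]
    refine lintegral_congr fun t => ?_
    by_cases ht : t ∈ D q
    · rw [indicator_of_mem ht, ENNReal.ofReal_coe_nnreal]
      exact ht.2
    · rw [indicator_of_notMem ht]
  rw [h1, add_zero]
  exact hle

/-- Each x splits into its restriction to the support, where f is bounded by the pairing with v, and
a remainder on which f ≤ 0 by hypothesis and the pairing is zero. The resulting inequality of linear
functionals, applied to −x as well, is an equality. -/
theorem isSmoothPoint_of_forall_apply_nonpos {u : Φ.space} (hu0 : u ≠ 0)
    (hu : ∫⁻ t, ‖(u : T →ₘ[μ] ℝ) t‖ₑ * bFun (complementary Φ.toFun) t ∂μ ≠ ∞)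
    (hle : modular μ (complementary Φ.toFun) ((Function.support (u : T →ₘ[μ] ℝ)).indicator
      (bFun (complementary Φ.toFun))) ≤ 1)
    (h : ∀ f : Φ.space →L[ℝ] ℝ, IsSupportFunctional u f → ∀ x : Φ.space,
      (∀ᵐ t ∂μ, (u : T →ₘ[μ] ℝ) t ≠ 0 → (x : T →ₘ[μ] ℝ) t = 0) → f x ≤ 0) :
    IsSmoothPoint u := by
  have hv := (Φ.modularReal_signBFun hu).trans_le hle
  refine ⟨hu0, Φ.pairing _ hv,
    Φ.isSupportFunctional_pairing hv hu0 (Φ.integral_mul_signBFun u.2 hu hv), fun f hf => ?_⟩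
  have key : ∀ x : Φ.space, f x ≤ Φ.pairing _ hv x := by
    intro x
    set S := Function.support (u : T →ₘ[μ] ℝ) with hS
    set y : T →ₘ[μ] ℝ := AEEqFun.mk (S.indicator (x : T →ₘ[μ] ℝ))
      ((x : T →ₘ[μ] ℝ).aestronglyMeasurable.indicator (measurableSet_support _)) with hy
    have hye : y =ᵐ[μ] S.indicator (x : T →ₘ[μ] ℝ) := AEEqFun.coeFn_mk _ _
    have hys : y ∈ Φ.space := by
      refine Φ.mem_space_of_abs_le x.2 ?_
      filter_upwards [hye] with t ht
      rw [ht]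
      by_cases hts : t ∈ S
      · rw [indicator_of_mem hts]
      · rw [indicator_of_notMem hts, abs_zero]
        exact abs_nonneg _
    set z : Φ.space := ⟨y, hys⟩ with hz
    have h1 : f z ≤ Φ.pairing _ hv z := by
      refine Φ.support_apply_le_of_support_subset hf hu hv ?_
      filter_upwards [hye] with t ht h0
      rw [ht, indicator_of_notMem (by simpa [hS] using h0)]
    have h2 : f (x - z) ≤ 0 := by
      refine h f hf _ ?_
      filter_upwards [hye, AEEqFun.coeFn_sub (x : T →ₘ[μ] ℝ) y] with t ht hsub h0
      rw [Submodule.coe_sub, hsub, Pi.sub_apply, ht, indicator_of_mem (show t ∈ S from h0), sub_self]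
    have h3 : Φ.pairing _ hv z = Φ.pairing _ hv x := by
      rw [pairing_apply, pairing_apply]
      refine integral_congr_ae ?_
      filter_upwards [hye, Φ.signBFun_eq_zero (u : T →ₘ[μ] ℝ)] with t ht h0
      by_cases hts : t ∈ S
      · rw [ht, indicator_of_mem hts]
      · rw [h0 (by simpa [hS] using hts), mul_zero, mul_zero]
    rw [map_sub] at h2
    linarith
  ext x
  refine le_antisymm (key x) ?_
  have := key (-x)
  rw [map_neg, map_neg] at this
  linarith

end MusielakOrlicz

/-! ### The characterization of smooth points. -/

theorem mainTheorem3 {T : Type*} [MeasurableSpace T] (μ : Measure T) [SigmaFinite μ]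
    (hμ : IsNonatomic μ) (Φ : MusielakOrlicz μ) (u : Φ.space) (hu : u ≠ 0)
    (hK : Φ.K (u : T →ₘ[μ] ℝ) = ∅) :
    IsSmoothPoint u ↔
      (modular μ (complementary Φ.toFun)
            ((Function.support (u : T →ₘ[μ] ℝ)).indicator (bFun (complementary Φ.toFun))) = 1 ∧
          ∀ᵐ t ∂μ, t ∉ Function.support (u : T →ₘ[μ] ℝ) →
            aFun (complementary Φ.toFun) t = 0) ∨
      (modular μ (complementary Φ.toFun) (bFun (complementary Φ.toFun)) < 1 ∧
          μ (Function.support (u : T →ₘ[μ] ℝ))ᶜ = 0) := by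
  have hfin := Φ.lintegral_mul_bFun_ne_top u.2 hK
  have hle := Φ.modular_indicator_bFun_le_one u.2 hK
  have hfull : μ (Function.support (u : T →ₘ[μ] ℝ))ᶜ = 0 →
      modular μ (complementary Φ.toFun)
        ((Function.support (u : T →ₘ[μ] ℝ)).indicator (bFun (complementary Φ.toFun)))
      = modular μ (complementary Φ.toFun) (bFun (complementary Φ.toFun)) := fun h0 => by
    refine lintegral_congr_ae ?_
    filter_upwards [measure_eq_zero_iff_ae_notMem.1 h0] with t ht
    rw [indicator_of_mem (by simpa using ht)]
  constructor
  · intro hs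
    -- As α ≤ 1 always holds, α < 1 leads to (ii) and α = 1 to (i).
    rcases hle.lt_or_eq with hlt | heq
    · by_cases h0 : μ (Function.support (u : T →ₘ[μ] ℝ))ᶜ = 0
      · exact Or.inr ⟨hfull h0 ▸ hlt, h0⟩
      · exact absurd hs (Φ.not_isSmoothPoint_of_lt_one hu hfin hlt h0)
    · refine Or.inl ⟨heq, ?_⟩
      by_contra ha
      exact Φ.not_isSmoothPoint_of_aFun_ne_zero hu hfin hle ha hs
  · rintro (⟨h1, ha⟩ | ⟨-, h0⟩)
    · refine Φ.isSmoothPoint_of_forall_apply_nonpos hu hfin hle fun f hf x hx => ?_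
      refine Φ.support_apply_nonpos_of_disjoint_support hf hK h1 hx ?_
      filter_upwards [hx, ha] with t h2 h3 h4
      exact h3 fun h5 => h4 (h2 h5)
    · refine Φ.isSmoothPoint_of_forall_apply_nonpos hu hfin hle fun f _ x hx => ?_
      have hx0 : x = 0 := by
        refine Subtype.ext (AEEqFun.ext ?_)
        filter_upwards [hx, measure_eq_zero_iff_ae_notMem.1 h0,
          AEEqFun.coeFn_zero (α := T) (β := ℝ) (μ := μ)] with t h2 h3 h4
        rw [Submodule.coe_zero, h4, h2 (by simpa using h3), Pi.zero_apply]
      rw [hx0, map_zero]
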